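/- **Setting.** Let $T$ be a rooted tree on $n$ vertices in which the children of each vertex are ordered from left to right, and let $w_1,\dots,w_n$ be its vertices in depth-first-search (DFS) preorder; "left", "right", "before" refer to this order. The level $L(u)$ of a vertex $u$ is its distance from the root; $D[u]$ is the set of descendants of $u$ (including $u$), $D(u):=D[u]\setminus\{u\}$ and $\nu(u):=|D[u]|$. The nearest left-cousin $l(u)$ is the right-most vertex on the level of $u$ that is to the left of $u$, and the nearest right-cousin $r(u)$ is the left-most vertex on the level of $u$ that is to the right of $u$ (each if it exists). The second ancestor of $u$ is the parent of the parent of $u$ if $L(u)\ge 2$, and the root otherwise. A set of vertices is $T$-admissible if it equals $\{w_1,\dots,w_t\}$ for some $0\le t\le n$. $T$ is a $(4,1)$-tree if for every vertex $u$: 1. if $l(l(u))$ exists, then $\nu(l(l(u)))+\nu(l(u))\ge\nu(u)$; 2. if $l(u)$ exists, then $\nu(l(u))\ge\frac14\nu(u)$; 3. if $u$ is not the right-most vertex on its level, then $\nu(u)\ge\nu(u')$ for every vertex $u'$ with $L(u')\ge L(u)+1$; 4. if $l(u)$ exists and $u$ has a child, then $l(u)$ has a child. $G^2_T$ is the simple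 graph on $V(T)$ in which each vertex $u$ is joined to the following vertices (other than itself): * all $w\in D(u)$; * all $w\in D[a]$, for every sibling $a$ of $u$ to the left of $u$; * all $w\in D[l(u^*)]$, where $u^*$ is the parent of $u$, if $u^*$ and $l(u^*)$ exist; * each existing $a\in\{u',l(u'),r(u')\}$, where $u'$ is the second ancestor of $u$, and every $w\in D(a)$ with $L(w)\le L(u)$. (Two vertices are adjacent if either is joined to the other by these rules.) **Statement.** Let $T$ be an $n$-vertex $(4,1)$-tree with root $v$, and let $v_1,\dots,v_t$ be the children of $v$ from left to right. Then: (a) $G^2_T$ contains every $n$-vertex tree as a subgraph. (b) For every forest $T'$ on $n'\le n$ vertices and all (not necessarily distinct) $x_1,x_2\in V(T')$, there is an injective graph homomorphism $\phi:T'\to G^2_T$ such that $V(T)\setminus\phi(V(T'))$ is $T$-admissible, $L(\phi(x_1))=\min\{L(\phi(y)):y\in V(T')\}$, and, if $t=2$ and $n-2\ge n'\ge\nu(v_2)\ge 2$, then moreover $L(\phi(x_2))\le 2$. (c) $G^2_T$ is interval-universal with respect to the DFS preorder: for all integers $i,m\ge0$ with $i+m\le n$, the subgraph of $G^2_T$ induced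 by $\{w_{i+1},\dots,w_{i+m}\}$ contains every $m$-vertex tree as a subgraph. -/

import Mathlib

universe u v

/-- A rooted tree on the vertex set `V`, given by its root and its parent map. The root is, by
convention, its own parent, and every vertex reaches the root by iterating the parent map; thus
`parent^[i] u` is the `i`-th ancestor of `u`, and it is the root when `i` exceeds the level
of `u`. -/
structure ParentTree (V : Type u) where
  root : V
  parent : V → V
  parent_root : parent root = root
  exists_iterate_eq_root : ∀ u, ∃ i, parent^[i] u = root

namespace ParentTree

variable {V : Type u} (T : ParentTree V)

/-- The level of `u`: its distance from the root. -/
noncomputable def level (u : V) : ℕ := sInf {i : ℕ | T.parent^[i] u = T.root}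

/-- The set `D[u]` of all descendants of `u`, including `u` itself. -/
def desc (u : V) : Set V := {w | ∃ i : ℕ, T.parent^[i] w = u}

/-- `ν(u) = |D[u]|`. -/
noncomputable def nu (u : V) : ℕ := (T.desc u).ncard

/-- The set of children of `u`. -/
def children (u : V) : Set V := {c | c ≠ T.root ∧ T.parent c = u}

/-- Two distinct vertices are siblings if they are children of the same vertex. -/
def IsSibling (a b : V) : Prop :=
  a ≠ b ∧ a ≠ T.root ∧ b ≠ T.root ∧ T.parent a = T.parent b

end ParentTree

/-- A DFS-ordered tree: a rooted tree on a linearly ordered vertex set, the linear order being the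
DFS preorder determined by the left-to-right order of the children of each vertex. (The order of
the children is the restriction of the linear order to siblings.) In that preorder `u` comes
before `w` if and only if either `w` is a proper descendant of `u`, or `u` and `w` lie in the
branches of two siblings `a` and `b` with `a` to the left of `b`. -/
structure DFSTree (V : Type u) [LinearOrder V] extends ParentTree V where
  lt_iff : ∀ u w : V, u < w ↔
    (w ≠ u ∧ w ∈ toParentTree.desc u) ∨
      ∃ a b : V, toParentTree.IsSibling a b ∧ a < b ∧
        u ∈ toParentTree.desc a ∧ w ∈ toParentTree.desc b

namespace DFSTree

variable {V : Type u} [LinearOrder V] (T : DFSTree V)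

/-- `p` is the nearest left-cousin `l(u)` of `u`: the right-most vertex on the level of `u` among
those to the left of `u`. It exists for at most one `p`, and for none if `u` is the left-most
vertex on its level. -/
def IsNearestLeftCousin (p u : V) : Prop :=
  IsGreatest {w : V | T.level w = T.level u ∧ w < u} p

/-- `p` is the nearest right-cousin `r(u)` of `u`: the left-most vertex on the level of `u` among
those to the right of `u`. -/
def IsNearestRightCousin (p u : V) : Prop :=
  IsLeast {w : V | T.level w = T.level u ∧ u < w} p

/-- A `(K, s)`-tree. -/
structure IsKsTree (K s : ℕ) : Prop where
  /-- If `p = l(u)` and `q = l(l(u))` exist, then `ν(q) + ν(p) ≥ ν(u)`. -/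
  nu_le_add : ∀ u p q : V, T.IsNearestLeftCousin p u → T.IsNearestLeftCousin q p →
    T.nu u ≤ T.nu q + T.nu p
  /-- If `p = l(u)` exists, then `ν(p) ≥ ν(u) / K`. -/
  nu_le_mul : ∀ u p : V, T.IsNearestLeftCousin p u → (T.nu u : ℝ) / K ≤ T.nu p
  /-- If `u` is not the right-most vertex on its level, then `ν(u) ≥ ν(u')` for all `u'` whose
  level is at least that of `u` plus `s`. -/
  nu_le_of_level : ∀ u : V, (∃ w : V, T.level w = T.level u ∧ u < w) →
    ∀ u' : V, T.level u + s ≤ T.level u' → T.nu u' ≤ T.nu u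
  /-- If `u` has a child and `p = l(u)` exists, then `p` has a child. -/
  children_nonempty : ∀ u p : V, T.IsNearestLeftCousin p u →
    (T.children u).Nonempty → (T.children p).Nonempty

/-- The arcs `u → w` of the directed graph that is `h`-generated by the DFS-ordered tree `T`.
(Loops are allowed here, and are discarded in the graph below.) -/
inductive Arc (h : ℕ) : V → V → Prop
  /-- `w` is a proper descendant of `u`. -/
  | descendant {u w : V} (hne : w ≠ u) (hw : w ∈ T.desc u) : Arc h u w
  /-- `w` is a left-sibling `a` of `u` or a descendant of `a`. -/
  | leftSibling {u a w : V} (ha : T.IsSibling a u) (hlt : a < u) (hw : w ∈ T.desc a) : Arc h u w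
  /-- `w` is the nearest left-cousin `p` of the parent of `u` or a descendant of `p`. -/
  | parentCousin {u p w : V} (hu : u ≠ T.root) (hp : T.IsNearestLeftCousin p (T.parent u))
      (hw : w ∈ T.desc p) : Arc h u w
  /-- `w` is one of `u'`, `l(u')`, `r(u')`, where `u'` is the `h`-th ancestor of `u`; or `w` is a
  proper descendant of one of them and its level is at most that of `u`. -/
  | ancestor {u a w : V}
      (ha : a = T.parent^[h] u ∨ T.IsNearestLeftCousin a (T.parent^[h] u) ∨
        T.IsNearestRightCousin a (T.parent^[h] u))
      (hw : w = a ∨ (w ≠ a ∧ w ∈ T.desc a ∧ T.level w ≤ T.level u)) : Arc h u w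

/-- The graph `G^h_T` that is `h`-generated by `T`: the simple undirected graph underlying the
directed graph above. -/
def generated (h : ℕ) : SimpleGraph V := SimpleGraph.fromRel (T.Arc h)

/-- A set of vertices is `T`-admissible if it is an initial segment of the DFS preorder of `T`,
that is, if it consists of the first `t` vertices in that order for some `t`. -/
def IsAdmissible (_T : DFSTree V) (S : Set V) : Prop := IsLowerSet S

end DFSTree

/-- `G` contains every tree on `m` vertices as a subgraph. -/
def IsTreeUniversal {V : Type u} (m : ℕ) (G : SimpleGraph V) : Prop :=
  ∀ F : SimpleGraph (Fin m), F.IsTree → F.IsContained G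

/-- `G` is interval-universal with respect to the ordering `x 0, …, x (n - 1)` of its vertices:
each interval of `m` consecutive vertices in this ordering induces a subgraph that contains every
tree on `m` vertices. -/
def IsIntervalUniversalWrt {V : Type u} {n : ℕ} (G : SimpleGraph V) (x : Fin n ≃ V) : Prop :=
  ∀ i m : ℕ, i + m ≤ n →
    IsTreeUniversal m (G.induce {y : V | ∃ j : Fin n, i ≤ (j : ℕ) ∧ (j : ℕ) < i + m ∧ x j = y})

/-! The forest is embedded from the right. Every partial image is a final segment of the part of the
tree still available, so what remains is again a lower set of the preorder, and the argument can be
repeated there. The induction (`Embeds`, proved in `embeds`) places a piece `S` of the forest on the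
last `S.card` vertices of the branches at a set `A` of roots on one level, with `x₁` as high as
possible. Height is the lever: if the final segment is long enough to contain a root, then `x₁` sits
on a root, and a root is adjacent to everything before it in these branches. A part joined to the
rest through a single vertex `y` can therefore be placed with `y` on a root, and the rest goes to
its left without any further constraint (`step_cut`).

One or two branches are reduced to the branches at the children of their roots (`step_one`,
`step_two`). Let there be three or more, the left-most being needed, and let the right-most have `a`
vertices and its left neighbour `p + 2`. A rooted forest can be cut at one vertex into a part of
prescribed size up to a factor of about two (`exists_cut`). As `a` is at most the sum of the two
preceding branches, such a cut suffices unless there are exactly three branches and the two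
right-most ones have fewer than `2 * a` vertices.

In that last case a part of suitable size may have to be attached to the rest through two vertices
`y` and `u` (`exists_split`; here `a ≤ 4 * (p + 2)` enters). The vertex `y` goes to the right-most
root, the neighbours of `u` in the part go to children of the two right-most roots
(`exists_emb_split`), and `u` itself must land at most one level below the roots. Vertices this high
are pairwise adjacent, thanks to the arcs from second ancestors. The clause on `x₂` in the induction
hypothesis for two branches provides this position for `u` (`step_split`). -/

set_option linter.unusedSectionVars false

/-! ### Rooted trees: levels, descendants, and sizes of parts below given vertices. -/

namespace ParentTree

variable {V : Type u} (P : ParentTree V)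

lemma iterate_root (i : ℕ) : P.parent^[i] P.root = P.root := by
  induction i with
  | zero => rfl
  | succ k ih => rw [Function.iterate_succ_apply, P.parent_root, ih]

lemma iterate_level (u : V) : P.parent^[P.level u] u = P.root :=
  Nat.sInf_mem (s := {i : ℕ | P.parent^[i] u = P.root}) (P.exists_iterate_eq_root u)

lemma level_le {u : V} {i : ℕ} (h : P.parent^[i] u = P.root) : P.level u ≤ i :=
  Nat.sInf_le h

lemma level_root : P.level P.root = 0 := Nat.le_zero.1 (P.level_le rfl)

lemma level_eq_zero {u : V} (h : P.level u = 0) : u = P.root := by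
  have := P.iterate_level u
  rwa [h] at this

lemma level_eq_succ {u : V} (hu : u ≠ P.root) : P.level u = P.level (P.parent u) + 1 := by
  apply le_antisymm
  · apply P.level_le
    rw [Function.iterate_succ_apply]
    exact P.iterate_level _
  · have h0 : P.level u ≠ 0 := fun h => hu (P.level_eq_zero h)
    obtain ⟨k, hk⟩ := Nat.exists_eq_succ_of_ne_zero h0
    have := P.iterate_level u
    rw [hk, Nat.succ_eq_add_one, Function.iterate_succ_apply] at this
    have := P.level_le this
    omega

lemma mem_desc_self (u : V) : u ∈ P.desc u := ⟨0, rfl⟩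

lemma mem_desc_root (u : V) : u ∈ P.desc P.root := P.exists_iterate_eq_root u

lemma desc_trans {u v w : V} (h₁ : u ∈ P.desc v) (h₂ : v ∈ P.desc w) : u ∈ P.desc w := by
  obtain ⟨i, rfl⟩ := h₁
  obtain ⟨j, rfl⟩ := h₂
  exact ⟨j + i, Function.iterate_add_apply ..⟩

lemma mem_desc_parent (u : V) : u ∈ P.desc (P.parent u) := ⟨1, rfl⟩

lemma mem_desc_of_parent {u w : V} (h : P.parent w ∈ P.desc u) : w ∈ P.desc u :=
  P.desc_trans (P.mem_desc_parent w) h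

lemma eq_or_parent_mem_desc {u w : V} (h : w ∈ P.desc u) : w = u ∨ P.parent w ∈ P.desc u := by
  obtain ⟨i, hi⟩ := h
  cases i with
  | zero => exact Or.inl hi
  | succ k => exact Or.inr ⟨k, hi⟩

lemma root_mem_desc {u : V} (h : P.root ∈ P.desc u) : u = P.root := by
  obtain ⟨i, hi⟩ := h
  rw [P.iterate_root] at hi
  exact hi.symm

lemma parent_mem_desc {u w : V} (h : w ∈ P.desc u) (hne : w ≠ u) :
    w ≠ P.root ∧ P.parent w ∈ P.desc u := by
  refine ⟨?_, (P.eq_or_parent_mem_desc h).resolve_left hne⟩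
  rintro rfl
  exact hne (P.root_mem_desc h).symm

lemma level_le_of_mem_desc {u w : V} (h : w ∈ P.desc u) : P.level u ≤ P.level w := by
  obtain ⟨i, rfl⟩ := h
  induction i generalizing w with
  | zero => rfl
  | succ k ih =>
    rw [Function.iterate_succ_apply]
    refine (ih (w := P.parent w)).trans ?_
    by_cases hw : w = P.root
    · rw [hw, P.parent_root]
    · rw [P.level_eq_succ hw]; omega

lemma eq_of_mem_desc {u w : V} (h : w ∈ P.desc u) (hl : P.level w ≤ P.level u) : w = u := by
  by_contra hne
  obtain ⟨hr, hp⟩ := P.parent_mem_desc h hne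
  have := P.level_le_of_mem_desc hp
  rw [P.level_eq_succ hr] at hl
  omega

lemma level_of_mem_children {c u : V} (h : c ∈ P.children u) : P.level c = P.level u + 1 := by
  rw [P.level_eq_succ h.1, h.2]

lemma mem_desc_of_mem_children {c u : V} (h : c ∈ P.children u) : c ∈ P.desc u := ⟨1, h.2⟩

/-- Two vertices with a common descendant are comparable. -/
lemma mem_desc_or_mem_desc {a b w : V} (ha : w ∈ P.desc a) (hb : w ∈ P.desc b) :
    a ∈ P.desc b ∨ b ∈ P.desc a := by
  obtain ⟨i, rfl⟩ := ha
  obtain ⟨j, rfl⟩ := hb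
  rcases le_total i j with h | h
  · left
    refine ⟨j - i, ?_⟩
    rw [← Function.iterate_add_apply, Nat.sub_add_cancel h]
  · right
    refine ⟨i - j, ?_⟩
    rw [← Function.iterate_add_apply, Nat.sub_add_cancel h]

lemma eq_of_level_eq_of_mem_desc {a b w : V} (ha : w ∈ P.desc a) (hb : w ∈ P.desc b)
    (hl : P.level a = P.level b) : a = b := by
  rcases P.mem_desc_or_mem_desc ha hb with h | h
  · exact P.eq_of_mem_desc h hl.le
  · exact (P.eq_of_mem_desc h hl.ge).symm

lemma exists_child_of_mem_desc {u w : V} (h : w ∈ P.desc u) (hne : w ≠ u) :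
    ∃ c ∈ P.children u, w ∈ P.desc c := by
  obtain ⟨i, hi⟩ := h
  induction i generalizing w with
  | zero => exact absurd hi hne
  | succ k ih =>
    rw [Function.iterate_succ_apply] at hi
    have hr : w ≠ P.root := by
      rintro rfl
      rw [P.parent_root, P.iterate_root] at hi
      exact hne hi
    by_cases hp : P.parent w = u
    · exact ⟨w, ⟨hr, hp⟩, P.mem_desc_self w⟩
    · obtain ⟨c, hc, hw⟩ := ih hp hi
      exact ⟨c, hc, P.mem_desc_of_parent hw⟩

open Classical in
/-- The elements of `H` below some element of `A`. -/
noncomputable def below (A H : Finset V) : Finset V := H.filter fun w => ∃ a ∈ A, w ∈ P.desc a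

variable {P}

lemma mem_below {A H : Finset V} {w : V} :
    w ∈ P.below A H ↔ w ∈ H ∧ ∃ a ∈ A, w ∈ P.desc a := by
  classical
  simp [below]

lemma mem_below_singleton {a : V} {H : Finset V} {w : V} :
    w ∈ P.below {a} H ↔ w ∈ H ∧ w ∈ P.desc a := by
  simp [mem_below]

lemma below_subset (A H : Finset V) : P.below A H ⊆ H := fun _ h => (mem_below.1 h).1

lemma below_mono {A A' H H' : Finset V} (hA : A ⊆ A') (hH : H ⊆ H') :
    P.below A H ⊆ P.below A' H' := fun _ h => by
  obtain ⟨h1, a, h2, h3⟩ := mem_below.1 h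
  exact mem_below.2 ⟨hH h1, a, hA h2, h3⟩

lemma self_mem_below {A H : Finset V} {a : V} (ha : a ∈ A) (hH : a ∈ H) : a ∈ P.below A H :=
  mem_below.2 ⟨hH, a, ha, P.mem_desc_self a⟩

lemma below_empty (H : Finset V) : P.below ∅ H = ∅ := by
  ext; simp [mem_below]

variable [DecidableEq V]

lemma below_union (A B H : Finset V) : P.below (A ∪ B) H = P.below A H ∪ P.below B H := by
  ext w
  simp only [mem_below, Finset.mem_union]
  constructor
  · rintro ⟨h, a, ha | ha, hw⟩
    · exact Or.inl ⟨h, a, ha, hw⟩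
    · exact Or.inr ⟨h, a, ha, hw⟩
  · rintro (⟨h, a, ha, hw⟩ | ⟨h, a, ha, hw⟩)
    · exact ⟨h, a, Or.inl ha, hw⟩
    · exact ⟨h, a, Or.inr ha, hw⟩

lemma disjoint_below {A B H : Finset V} {l : ℕ} (hA : ∀ a ∈ A, P.level a = l)
    (hB : ∀ a ∈ B, P.level a = l) (hAB : Disjoint A B) : Disjoint (P.below A H) (P.below B H) := by
  rw [Finset.disjoint_left]
  intro w h1 h2
  obtain ⟨-, a, ha, hwa⟩ := mem_below.1 h1
  obtain ⟨-, b, hb, hwb⟩ := mem_below.1 h2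
  have := P.eq_of_level_eq_of_mem_desc hwa hwb ((hA a ha).trans (hB b hb).symm)
  subst this
  exact Finset.disjoint_left.1 hAB ha hb

lemma card_below_union {A B H : Finset V} {l : ℕ} (hA : ∀ a ∈ A, P.level a = l)
    (hB : ∀ a ∈ B, P.level a = l) (hAB : Disjoint A B) :
    (P.below (A ∪ B) H).card = (P.below A H).card + (P.below B H).card := by
  rw [below_union, Finset.card_union_of_disjoint (disjoint_below hA hB hAB)]

lemma card_below_eq_sum {A H : Finset V} {l : ℕ} (hA : ∀ a ∈ A, P.level a = l) :
    (P.below A H).card = ∑ a ∈ A, (P.below {a} H).card := by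
  have : P.below A H = A.biUnion fun a => P.below {a} H := by
    ext w
    simp only [mem_below, Finset.mem_biUnion, Finset.mem_singleton, exists_eq_left]
    tauto
  rw [this, Finset.card_biUnion]
  intro a ha b hb hne
  exact disjoint_below (l := l) (by simpa using hA a ha) (by simpa using hA b hb) (by simpa using hne)

open Classical in
/-- The children of `u` that lie in `H`. -/
noncomputable def childrenIn (P : ParentTree V) (u : V) (H : Finset V) : Finset V :=
  H.filter (· ∈ P.children u)

lemma mem_childrenIn {u c : V} {H : Finset V} :
    c ∈ P.childrenIn u H ↔ c ∈ H ∧ c ∈ P.children u := by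
  simp [childrenIn]

lemma childrenIn_subset (u : V) (H : Finset V) : P.childrenIn u H ⊆ H :=
  fun _ h => (mem_childrenIn.1 h).1

lemma level_of_mem_childrenIn {u c : V} {H : Finset V} (h : c ∈ P.childrenIn u H) :
    P.level c = P.level u + 1 := P.level_of_mem_children (mem_childrenIn.1 h).2

lemma notMem_below_childrenIn (u : V) (H : Finset V) : u ∉ P.below (P.childrenIn u H) H := by
  intro h
  obtain ⟨-, c, hc, hu⟩ := mem_below.1 h
  have := P.level_le_of_mem_desc hu
  rw [level_of_mem_childrenIn hc] at this
  omega

/-- If `H` contains, with each of its elements below `u`, the ancestors of it below `u`, then the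
part of `H` below `u` is the union of `{u}` and of the parts below the children of `u` in `H`. -/
lemma below_singleton_eq {u : V} {H : Finset V} (hu : u ∈ H)
    (hH : ∀ w ∈ H, ∀ c ∈ P.children u, w ∈ P.desc c → c ∈ H) :
    P.below {u} H = insert u (P.below (P.childrenIn u H) H) := by
  ext w
  rw [mem_below_singleton]
  simp only [Finset.mem_insert, mem_below, mem_childrenIn]
  constructor
  · rintro ⟨h1, h2⟩
    by_cases hw : w = u
    · exact Or.inl hw
    · obtain ⟨c, hc, hwc⟩ := P.exists_child_of_mem_desc h2 hw
      exact Or.inr ⟨h1, c, ⟨hH w h1 c hc hwc, hc⟩, hwc⟩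
  · rintro (rfl | ⟨h1, c, ⟨-, hc⟩, hw⟩)
    · exact ⟨hu, P.mem_desc_self w⟩
    · exact ⟨h1, P.desc_trans hw (P.mem_desc_of_mem_children hc)⟩

lemma card_below_singleton {u : V} {H : Finset V} (hu : u ∈ H)
    (hH : ∀ w ∈ H, ∀ c ∈ P.children u, w ∈ P.desc c → c ∈ H) :
    (P.below {u} H).card = (P.below (P.childrenIn u H) H).card + 1 := by
  rw [below_singleton_eq hu hH, Finset.card_insert_of_notMem (notMem_below_childrenIn u H)]

end ParentTree

/-! ### The preorder and its lower sets. -/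

namespace DFSTree

variable {V : Type u} [LinearOrder V] (T : DFSTree V)

open ParentTree

lemma lt_of_mem_desc {u w : V} (h : w ∈ T.desc u) (hne : w ≠ u) : u < w :=
  (T.lt_iff u w).2 (Or.inl ⟨hne, h⟩)

lemma le_of_mem_desc {u w : V} (h : w ∈ T.desc u) : u ≤ w := by
  by_cases hne : w = u
  · exact hne.ge
  · exact (T.lt_of_mem_desc h hne).le

lemma root_le (u : V) : T.root ≤ u := T.le_of_mem_desc (T.mem_desc_root u)

/-- The branches of two vertices on the same level are ordered like the vertices. -/
lemma desc_lt_desc {a b u w : V} (hl : T.level a = T.level b) (hab : a < b) (hu : u ∈ T.desc a)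
    (hw : w ∈ T.desc b) : u < w := by
  rcases (T.lt_iff a b).1 hab with ⟨hne, h⟩ | ⟨c, d, hs, hcd, ha, hb⟩
  · exact absurd (T.eq_of_mem_desc h hl.ge) hne
  · exact (T.lt_iff u w).2 (Or.inr ⟨c, d, hs, hcd, T.desc_trans hu ha, T.desc_trans hw hb⟩)

/-- The ancestors on a given level are ordered like the vertices. -/
lemma le_of_mem_desc_of_le {a b u w : V} (hl : T.level a = T.level b) (hu : u ∈ T.desc a)
    (hw : w ∈ T.desc b) (h : u ≤ w) : a ≤ b := by
  by_contra hab
  exact absurd (T.desc_lt_desc hl.symm (not_le.1 hab) hw hu) (not_lt.2 h)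

lemma parent_le_parent {u w : V} (hu : u ≠ T.root) (hw : w ≠ T.root) (hl : T.level u = T.level w)
    (h : u ≤ w) : T.parent u ≤ T.parent w := by
  refine T.le_of_mem_desc_of_le ?_ (T.mem_desc_parent u) (T.mem_desc_parent w) h
  have h1 := T.level_eq_succ hu
  have h2 := T.level_eq_succ hw
  omega

lemma not_isNearestLeftCousin_between {p u w : V} (h : T.IsNearestLeftCousin p u)
    (hl : T.level w = T.level u) (h₁ : p ≤ w) (h₂ : w ≤ u) : w = p ∨ w = u := by
  rcases h₂.eq_or_lt with h₂ | h₂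
  · exact Or.inr h₂
  · exact Or.inl (le_antisymm (h.2 ⟨hl, h₂⟩) h₁)

lemma IsNearestLeftCousin.right {p u : V} (h : T.IsNearestLeftCousin p u) :
    T.IsNearestRightCousin u p := by
  refine ⟨⟨h.1.1.symm, h.1.2⟩, fun w hw => ?_⟩
  by_contra hlt
  have := h.2 ⟨hw.1.trans h.1.1, not_le.1 hlt⟩
  exact absurd hw.2 (not_lt.2 this)

variable {T}

/-- A lower set is closed under ancestors. -/
lemma mem_of_mem_desc {H : Finset V} (hH : IsLowerSet (H : Set V)) {a w : V} (hw : w ∈ H)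
    (h : w ∈ T.desc a) : a ∈ H := hH (T.le_of_mem_desc h) hw

lemma below_singleton {H : Finset V} (hH : IsLowerSet (H : Set V)) {u : V} (hu : u ∈ H) :
    T.below {u} H = insert u (T.below (T.childrenIn u H) H) :=
  below_singleton_eq hu fun _ hw _ _ hc => mem_of_mem_desc hH hw hc

lemma card_below {H : Finset V} (hH : IsLowerSet (H : Set V)) {u : V} (hu : u ∈ H) :
    (T.below {u} H).card = (T.below (T.childrenIn u H) H).card + 1 :=
  card_below_singleton hu fun _ hw _ _ hc => mem_of_mem_desc hH hw hc

lemma card_below_le_nu [Finite V] (u : V) (H : Finset V) : (T.below {u} H).card ≤ T.nu u := by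
  rw [nu, ← Set.ncard_coe_finset]
  apply Set.ncard_le_ncard _ (Set.toFinite _)
  intro w hw
  exact (mem_below_singleton.1 hw).2

lemma card_below_eq_nu {u : V} {H : Finset V} (h : T.desc u ⊆ H) :
    (T.below {u} H).card = T.nu u := by
  rw [nu, ← Set.ncard_coe_finset]
  congr 1
  ext w
  simp only [Finset.mem_coe, mem_below_singleton]
  exact ⟨fun h => h.2, fun hw => ⟨h hw, hw⟩⟩

lemma desc_subset_of_lt {H : Finset V} (hH : IsLowerSet (H : Set V)) {a b : V} (hb : b ∈ H)
    (hl : T.level a = T.level b) (hab : a < b) : T.desc a ⊆ H := fun _ hw =>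
  hH (T.desc_lt_desc hl hab hw (T.mem_desc_self b)).le hb

/-! ### Sets of roots and the adjacencies between their branches. -/

variable (T) in
/-- A set of vertices on the level `l` that can play the role of the children of the root in an
inductive embedding argument for the graph generated by `T`. -/
structure IsRoots (l : ℕ) (A : Finset V) : Prop where
  level_eq : ∀ a ∈ A, T.level a = l
  convex : ∀ a ∈ A, ∀ b ∈ A, ∀ w, T.level w = l → a ≤ w → w ≤ b → w ∈ A
  adj_of_lt : ∀ a ∈ A, ∀ b ∈ A, a < b → ∀ w ∈ T.desc a, (T.generated 2).Adj b w
  adj_of_level : ∀ a ∈ A, ∀ b ∈ A, ∀ u ∈ T.desc a, ∀ w ∈ T.desc b, T.level u ≤ l + 1 →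
    T.level w ≤ l + 1 → u ≠ w → (T.generated 2).Adj u w

lemma adj_of_arc {h : ℕ} {u w : V} (hne : u ≠ w) (ha : T.Arc h u w) : (T.generated h).Adj u w := by
  rw [generated, SimpleGraph.fromRel_adj]
  exact ⟨hne, Or.inl ha⟩

lemma adj_desc {h : ℕ} {u w : V} (hne : w ≠ u) (hw : w ∈ T.desc u) : (T.generated h).Adj u w :=
  adj_of_arc hne.symm (.descendant hne hw)

lemma IsRoots.subset {l : ℕ} {A B : Finset V} (hA : T.IsRoots l A) (hBA : B ⊆ A)
    (hB : ∀ a ∈ B, ∀ b ∈ B, ∀ w ∈ A, a ≤ w → w ≤ b → w ∈ B) : T.IsRoots l B where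
  level_eq a ha := hA.level_eq a (hBA ha)
  convex a ha b hb w hw h1 h2 := hB a ha b hb w (hA.convex a (hBA ha) b (hBA hb) w hw h1 h2) h1 h2
  adj_of_lt a ha b hb := hA.adj_of_lt a (hBA ha) b (hBA hb)
  adj_of_level a ha b hb := hA.adj_of_level a (hBA ha) b (hBA hb)

lemma isRoots_root : T.IsRoots 0 {T.root} where
  level_eq a ha := by rw [Finset.mem_singleton.1 ha, T.level_root]
  convex a _ b _ w hw _ _ := by
    rw [Finset.mem_singleton]
    exact T.level_eq_zero hw
  adj_of_lt a ha b hb hab := by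
    rw [Finset.mem_singleton.1 ha, Finset.mem_singleton.1 hb] at hab
    exact absurd hab (lt_irrefl _)
  adj_of_level a _ b _ u _ w _ hlu hlw hne := by
    by_cases hu : u = T.root
    · subst hu
      exact adj_desc hne.symm (T.mem_desc_root w)
    by_cases hw : w = T.root
    · subst hw
      exact (adj_desc hne (T.mem_desc_root u)).symm
    have := T.level_eq_succ hu
    refine adj_of_arc hne (.ancestor (a := T.root) (Or.inl ?_)
      (Or.inr ⟨hw, T.mem_desc_root w, by omega⟩))
    -- Here `u` is on level 1; since the root is its own parent, the second ancestor of `u` is the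
    -- root.
    have h2 := T.level_eq_zero (u := T.parent u) (by omega)
    rw [Function.iterate_succ_apply, h2, T.iterate_root]

/-- The condition `hQ'` leaves at most two parents, consecutive on their level. A child is then
joined to earlier branches by the left-sibling arcs (same parent) or the parent-cousin arcs (other
parent). A vertex on level `m + 2` has its second ancestor in `Q`; the other parent is the left or
right cousin of that ancestor, so the ancestor arcs reach every vertex of the branches that is not
on a deeper level. -/
lemma isRoots_children {H : Finset V} (hH : IsLowerSet (H : Set V)) {m : ℕ} {Q A : Finset V}
    (hQ : ∀ p ∈ Q, T.level p = m)
    (hQ' : ∀ p ∈ Q, ∀ q ∈ Q, p < q → T.IsNearestLeftCousin p q)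
    (hA : ∀ c, c ∈ A ↔ c ∈ H ∧ ∃ p ∈ Q, c ∈ T.children p) : T.IsRoots (m + 1) A := by
  have lev : ∀ a ∈ A, T.level a = m + 1 := by
    intro a ha
    obtain ⟨-, p, hp, hc⟩ := (hA a).1 ha
    rw [T.level_of_mem_children hc, hQ p hp]
  have lt : ∀ a ∈ A, ∀ b ∈ A, a < b → ∀ w ∈ T.desc a, (T.generated 2).Adj b w := by
    intro a ha b hb hab w hw
    have hwb := T.desc_lt_desc ((lev a ha).trans (lev b hb).symm) hab hw (T.mem_desc_self b)
    obtain ⟨-, p, hp, hap⟩ := (hA a).1 ha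
    obtain ⟨-, q, hq, hbq⟩ := (hA b).1 hb
    have hpq : p ≤ q := by
      rw [← hap.2, ← hbq.2]
      exact T.parent_le_parent hap.1 hbq.1 ((lev a ha).trans (lev b hb).symm) hab.le
    rcases hpq.eq_or_lt with rfl | hpq
    · exact adj_of_arc hwb.ne' (.leftSibling ⟨hab.ne, hap.1, hbq.1, hap.2.trans hbq.2.symm⟩ hab hw)
    · refine adj_of_arc hwb.ne' (.parentCousin (p := p) hbq.1 ?_
        (T.desc_trans hw (T.mem_desc_of_mem_children hap)))
      rw [hbq.2]
      exact hQ' p hp q hq hpq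
  have low : ∀ a ∈ A, ∀ b ∈ A, ∀ u ∈ T.desc a, ∀ w ∈ T.desc b, T.level u ≤ m + 2 →
      T.level w ≤ T.level u → u ≠ w → (T.generated 2).Adj u w := by
    intro a ha b hb u hu w hw hlu hlw hne
    obtain ⟨-, p, hp, hap⟩ := (hA a).1 ha
    obtain ⟨-, q, hq, hbq⟩ := (hA b).1 hb
    have hbw := T.level_le_of_mem_desc hw
    have hau := T.level_le_of_mem_desc hu
    rw [lev a ha] at hau
    rw [lev b hb] at hbw
    by_cases hl : T.level u = m + 1
    · have hu' := T.eq_of_mem_desc hu (by rw [hl, lev a ha])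
      have hw' := T.eq_of_mem_desc hw (by rw [lev b hb]; omega)
      subst hu' hw'
      rcases lt_or_gt_of_ne hne with h | h
      · exact (lt _ ha _ hb h _ (T.mem_desc_self _)).symm
      · exact lt _ hb _ ha h _ (T.mem_desc_self _)
    · have hua : u ≠ a := by
        rintro rfl
        exact hl (lev u ha)
      obtain ⟨hur, hpu⟩ := T.parent_mem_desc hu hua
      have h1 := T.level_eq_succ hur
      have h2 : T.parent u = a := T.eq_of_mem_desc hpu (by rw [lev a ha]; omega)
      have h3 : T.parent^[2] u = p := by
        rw [Function.iterate_succ_apply, h2]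
        exact hap.2
      have hwq : w ∈ T.desc q := T.desc_trans hw (T.mem_desc_of_mem_children hbq)
      have hne' : w ≠ q := by
        rintro rfl
        rw [hQ w hq] at hbw
        omega
      refine adj_of_arc hne (.ancestor (a := q) ?_ (Or.inr ⟨hne', hwq, hlw⟩))
      rw [h3]
      rcases lt_trichotomy p q with h | h | h
      · exact Or.inr (Or.inr (hQ' p hp q hq h).right)
      · exact Or.inl h.symm
      · exact Or.inr (Or.inl (hQ' q hq p hp h))
  refine ⟨lev, ?_, lt, ?_⟩
  · intro a ha b hb w hw h1 h2
    obtain ⟨-, p, hp, hap⟩ := (hA a).1 ha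
    obtain ⟨hbH, q, hq, hbq⟩ := (hA b).1 hb
    have hwr : w ≠ T.root := by
      rintro rfl
      rw [T.level_root] at hw
      omega
    have h3 := T.parent_le_parent hap.1 hwr ((lev a ha).trans hw.symm) h1
    have h4 := T.parent_le_parent hwr hbq.1 (hw.trans (lev b hb).symm) h2
    rw [hap.2] at h3
    rw [hbq.2] at h4
    have h5 := T.level_eq_succ hwr
    refine (hA w).2 ⟨hH h2 hbH, ?_⟩
    rcases (h3.trans h4).eq_or_lt with rfl | hpq
    · exact ⟨p, hp, hwr, le_antisymm h4 h3⟩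
    · rcases T.not_isNearestLeftCousin_between (hQ' p hp q hq hpq)
        (by rw [hQ q hq]; omega) h3 h4 with h | h
      · exact ⟨p, hp, hwr, h⟩
      · exact ⟨q, hq, hwr, h⟩
  · intro a ha b hb u hu w hw hlu hlw hne
    rcases le_total (T.level w) (T.level u) with h | h
    · exact low a ha b hb u hu w hw hlu h hne
    · exact (low b hb a ha w hw u hu hlw h hne.symm).symm

lemma isRoots_childrenIn {H : Finset V} (hH : IsLowerSet (H : Set V)) (v : V) :
    T.IsRoots (T.level v + 1) (T.childrenIn v H) := by
  refine isRoots_children hH (Q := {v}) (by simp) ?_ (by simp [mem_childrenIn])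
  intro p hp q hq h
  rw [Finset.mem_singleton.1 hp, Finset.mem_singleton.1 hq] at h
  exact absurd h (lt_irrefl _)

lemma isRoots_childrenIn_union {H : Finset V} (hH : IsLowerSet (H : Set V)) {p v : V}
    (h : T.IsNearestLeftCousin p v) :
    T.IsRoots (T.level v + 1) (T.childrenIn p H ∪ T.childrenIn v H) := by
  refine isRoots_children hH (Q := {p, v}) ?_ ?_ ?_
  · simpa using h.1.1
  · intro a ha b hb hab
    simp only [Finset.mem_insert, Finset.mem_singleton] at ha hb
    rcases ha with rfl | rfl <;> rcases hb with rfl | rfl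
    · exact absurd hab (lt_irrefl _)
    · exact h
    · exact absurd h.1.2 (not_lt.2 hab.le)
    · exact absurd hab (lt_irrefl _)
  · intro c
    simp only [Finset.mem_union, mem_childrenIn, Finset.mem_insert, Finset.mem_singleton]
    constructor
    · rintro (⟨h1, h2⟩ | ⟨h1, h2⟩)
      · exact ⟨h1, p, Or.inl rfl, h2⟩
      · exact ⟨h1, v, Or.inr rfl, h2⟩
    · rintro ⟨h1, q, rfl | rfl, h2⟩
      · exact Or.inl ⟨h1, h2⟩
      · exact Or.inr ⟨h1, h2⟩

end DFSTree

/-! ### Rooting a forest and cutting it into parts of prescribed size. -/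

/-- A subset of a sum that is minimal subject to being at least `k`. -/
lemma Finset.exists_minimal_sum {ι : Type*} [DecidableEq ι] (I : Finset ι) (s : ι → ℕ) (k : ℕ)
    (h : k ≤ ∑ i ∈ I, s i) :
    ∃ J ⊆ I, k ≤ ∑ i ∈ J, s i ∧ ∀ r ∈ J, ∑ i ∈ J.erase r, s i < k := by
  induction I using Finset.strongInduction with
  | H I ih =>
    by_cases hr : ∃ r ∈ I, k ≤ ∑ i ∈ I.erase r, s i
    · obtain ⟨r, hr, hk⟩ := hr
      obtain ⟨J, hJ, h1, h2⟩ := ih (I.erase r) (Finset.erase_ssubset hr) hk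
      exact ⟨J, hJ.trans (Finset.erase_subset _ _), h1, h2⟩
    · push Not at hr
      exact ⟨I, subset_rfl, h, hr⟩

namespace SimpleGraph

variable {W : Type v} [DecidableEq W] {F : SimpleGraph W}

/-- Every edge from `K` to `S \ K` ends in `y`. -/
def IsAttached (F : SimpleGraph W) (S K : Finset W) (y : W) : Prop :=
  ∀ v ∈ K, ∀ v' ∈ S, v' ∉ K → F.Adj v v' → v' = y

/-- A finite forest has a vertex of degree at most one other than a given vertex. -/
lemma IsAcyclic.exists_leaf (hF : F.IsAcyclic) {S : Finset W} {x : W} (hx : x ∈ S)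
    (hS : ∃ w ∈ S, w ≠ x) :
    ∃ w ∈ S, w ≠ x ∧ ∃ q ∈ S, q ≠ w ∧ ∀ v ∈ S, F.Adj w v → v = q := by
  classical
  have hc : (⊤ : SimpleGraph S).Connected := by
    have : Nonempty S := ⟨⟨x, hx⟩⟩
    exact connected_top
  -- The forest on `S` may be disconnected, so it is extended to a tree on `S`; a leaf of the tree
  -- other than `x` has the required property in the forest.
  obtain ⟨T, hle, -, hT⟩ := hc.exists_isTree_le_of_le_of_isAcyclic le_top (hF.induce (S : Set W))
  obtain ⟨w, hw, hwx⟩ := hS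
  have : Nontrivial S := ⟨⟨w, hw⟩, ⟨x, hx⟩, by simpa using hwx⟩
  obtain ⟨a, b, hab, ha, hb⟩ := hT.exists_ne_and_degree_eq_one
  have key : ∀ a : S, T.degree a = 1 → (a : W) ≠ x →
      ∃ w ∈ S, w ≠ x ∧ ∃ q ∈ S, q ≠ w ∧ ∀ v ∈ S, F.Adj w v → v = q := by
    intro a ha hax
    rw [degree_eq_one_iff_existsUnique_adj] at ha
    obtain ⟨q, hq, hu⟩ := ha
    refine ⟨a, a.2, hax, q, q.2, fun h => hq.ne (Subtype.ext h).symm, fun v hv hadj => ?_⟩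
    exact congrArg Subtype.val (hu ⟨v, hv⟩ (hle hadj))
  by_cases hax : (a : W) = x
  · exact key b hb fun hbx => hab (Subtype.ext (hax.trans hbx.symm))
  · exact key a ha hax

/-- `P` is a rooted tree that contains the part of `F` in `S`. -/
structure IsRooting (F : SimpleGraph W) (S : Finset W) (P : ParentTree W) : Prop where
  root_mem : P.root ∈ S
  parent_mem : ∀ w ∈ S, P.parent w ∈ S
  adj : ∀ u ∈ S, ∀ v ∈ S, F.Adj u v → P.parent u = v ∨ P.parent v = u

/-- A leaf other than `x` is removed, the remainder rooted, and the leaf hung on its only possible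
neighbour. Parent links need not be edges of `F`, so several components end up in one rooted tree.
-/
lemma IsAcyclic.exists_isRooting (hF : F.IsAcyclic) {S : Finset W} {x : W} (hx : x ∈ S) :
    ∃ P : ParentTree W, P.root = x ∧ F.IsRooting S P := by
  -- A parent map is total on `W`. Sending everything outside `S` directly to `x` keeps the root
  -- reachable when the parent of the removed leaf is redefined.
  suffices h : ∃ P : ParentTree W, P.root = x ∧ F.IsRooting S P ∧ ∀ w ∉ S, P.parent w = x by
    obtain ⟨P, h1, h2, -⟩ := h
    exact ⟨P, h1, h2⟩
  induction S using Finset.strongInduction with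
  | H S ih =>
    by_cases hS : ∃ w ∈ S, w ≠ x
    · obtain ⟨w, hw, hwx, q, hq, hqw, hadj⟩ := hF.exists_leaf hx hS
      obtain ⟨P, hr, hP, hout⟩ := ih (S.erase w) (Finset.erase_ssubset hw)
        (Finset.mem_erase.2 ⟨hwx.symm, hx⟩)
      have hmem : ∀ u ∈ S.erase w, ∀ i, (Function.update P.parent w q)^[i] u = P.parent^[i] u := by
        intro u hu i
        induction i generalizing u with
        | zero => rfl
        | succ k ihk =>
          rw [Function.iterate_succ_apply, Function.iterate_succ_apply,
            Function.update_of_ne (Finset.ne_of_mem_erase hu), ihk _ (hP.parent_mem u hu)]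
      have hreach : ∀ u ∈ S.erase w, ∃ i, (Function.update P.parent w q)^[i] u = P.root := by
        intro u hu
        obtain ⟨i, hi⟩ := P.exists_iterate_eq_root u
        exact ⟨i, by rw [hmem u hu, hi]⟩
      refine ⟨⟨P.root, Function.update P.parent w q, ?_, ?_⟩, hr, ⟨?_, ?_, ?_⟩, ?_⟩
      · rw [Function.update_of_ne (by rw [hr]; exact hwx.symm), P.parent_root]
      · intro u
        by_cases hu : u ∈ S.erase w
        · exact hreach u hu
        · by_cases huw : u = w
          · subst huw
            obtain ⟨i, hi⟩ := hreach q (Finset.mem_erase.2 ⟨hqw, hq⟩)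
            exact ⟨i + 1, by rw [Function.iterate_succ_apply, Function.update_self, hi]⟩
          · refine ⟨1, ?_⟩
            rw [Function.iterate_one, Function.update_of_ne huw, hout u hu, hr]
      · exact hr ▸ hx
      · intro u hu
        by_cases huw : u = w
        · subst huw
          simpa using hq
        · simp only [Function.update_of_ne huw]
          exact Finset.mem_of_mem_erase (hP.parent_mem u (Finset.mem_erase.2 ⟨huw, hu⟩))
      · intro u hu v hv huv
        by_cases huw : u = w
        · subst huw
          left
          simp [hadj v hv huv]
        · by_cases hvw : v = w
          · subst hvw
            right
            simp [hadj u hu huv.symm]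
          · simp only [Function.update_of_ne huw, Function.update_of_ne hvw]
            exact hP.adj u (Finset.mem_erase.2 ⟨huw, hu⟩) v (Finset.mem_erase.2 ⟨hvw, hv⟩) huv
      · intro u hu
        have huw : u ≠ w := by
          rintro rfl
          exact hu hw
        simp only [Function.update_of_ne huw]
        exact hout u fun h => hu (Finset.mem_of_mem_erase h)
    · push Not at hS
      refine ⟨⟨x, fun _ => x, rfl, fun u => ⟨1, rfl⟩⟩, rfl, ⟨hx, fun _ _ => hx, ?_⟩, fun _ _ => rfl⟩
      intro u hu v hv huv
      exact absurd ((hS u hu).trans (hS v hv).symm) huv.ne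

namespace IsRooting

open ParentTree

variable {S : Finset W} {P : ParentTree W}

lemma mem_of_mem_desc (h : F.IsRooting S P) {w a : W} (hw : w ∈ S) (ha : w ∈ P.desc a) : a ∈ S := by
  obtain ⟨i, rfl⟩ := ha
  induction i generalizing w with
  | zero => exact hw
  | succ k ih => exact ih (h.parent_mem w hw)

lemma card_below (h : F.IsRooting S P) {w : W} (hw : w ∈ S) :
    (P.below {w} S).card = (P.below (P.childrenIn w S) S).card + 1 :=
  card_below_singleton hw fun _ hv _ _ hc => h.mem_of_mem_desc hv hc

lemma below_singleton (h : F.IsRooting S P) {w : W} (hw : w ∈ S) :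
    P.below {w} S = insert w (P.below (P.childrenIn w S) S) :=
  below_singleton_eq hw fun _ hv _ _ hc => h.mem_of_mem_desc hv hc

lemma below_root (S : Finset W) (P : ParentTree W) : P.below {P.root} S = S := by
  ext w
  rw [mem_below_singleton]
  exact ⟨fun h => h.1, fun h => ⟨h, P.mem_desc_root w⟩⟩

/-- Edges of `F` join parent and child, so a branch can be left only along the link from its top to
the parent of the top. Consequently branches at a common vertex `y` are attached to the rest through
`y` alone. -/
lemma edge_below (h : F.IsRooting S P) {r v v' : W} (hv : v ∈ P.below {r} S) (hv' : v' ∈ S)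
    (hn : v' ∉ P.below {r} S) (hadj : F.Adj v v') : v = r ∧ v' = P.parent r := by
  rw [mem_below_singleton] at hv hn
  rcases h.adj v hv.1 v' hv' hadj with hp | hp
  · rcases P.eq_or_parent_mem_desc hv.2 with rfl | hd
    · exact ⟨rfl, hp.symm⟩
    · rw [hp] at hd
      exact absurd ⟨hv', hd⟩ hn
  · refine absurd ⟨hv', P.mem_desc_of_parent ?_⟩ hn
    rw [hp]
    exact hv.2

lemma isAttached_below (h : F.IsRooting S P) {y : W} {J : Finset W} (hJ : J ⊆ P.childrenIn y S) :
    F.IsAttached S (P.below J S) y := by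
  intro v hv v' hv' hn hadj
  obtain ⟨hvS, c, hc, hvc⟩ := mem_below.1 hv
  have hsub : P.below {c} S ⊆ P.below J S :=
    below_mono (Finset.singleton_subset_iff.2 hc) subset_rfl
  obtain ⟨-, h2⟩ := h.edge_below (mem_below_singleton.2 ⟨hvS, hvc⟩) hv' (fun h => hn (hsub h)) hadj
  rw [h2]
  exact (mem_childrenIn.1 (hJ hc)).2.2

lemma notMem_below_of_subset {y : W} {J : Finset W} (hJ : J ⊆ P.childrenIn y S) :
    y ∉ P.below J S := fun hy =>
  notMem_below_childrenIn y S (below_mono hJ subset_rfl hy)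

lemma card_below_eq_sum {y : W} {J : Finset W} (hJ : J ⊆ P.childrenIn y S) :
    (P.below J S).card = ∑ c ∈ J, (P.below {c} S).card :=
  ParentTree.card_below_eq_sum fun _ hc => level_of_mem_childrenIn (hJ hc)

lemma root_notMem_below {y : W} {J : Finset W} (hJ : J ⊆ P.childrenIn y S) :
    P.root ∉ P.below J S := by
  intro hr
  obtain ⟨-, c, hc, h⟩ := mem_below.1 hr
  exact (mem_childrenIn.1 (hJ hc)).2.1 (P.root_mem_desc h)

/-- Descend to a child as long as some child has more than `k` vertices in its branch. -/
lemma exists_lowest (h : F.IsRooting S P) {k : ℕ} {w : W} (hw : w ∈ S)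
    (hk : k + 1 ≤ (P.below {w} S).card) :
    ∃ u ∈ P.below {w} S, k + 1 ≤ (P.below {u} S).card ∧
      ∀ c ∈ P.childrenIn u S, (P.below {c} S).card ≤ k := by
  induction hn : (P.below {w} S).card using Nat.strong_induction_on generalizing w with
  | _ n ih =>
    by_cases hc : ∃ c ∈ P.childrenIn w S, k + 1 ≤ (P.below {c} S).card
    · obtain ⟨c, hc, hck⟩ := hc
      have hcS := childrenIn_subset _ _ hc
      have hsub : P.below {c} S ⊆ P.below (P.childrenIn w S) S :=
        below_mono (Finset.singleton_subset_iff.2 hc) subset_rfl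
      have h1 := Finset.card_le_card hsub
      have h2 := h.card_below hw
      obtain ⟨u, hu, h3⟩ := ih _ (by omega) hcS hck rfl
      refine ⟨u, ?_, h3⟩
      rw [h.below_singleton hw]
      exact Finset.mem_insert_of_mem (hsub hu)
    · push Not at hc
      exact ⟨w, self_mem_below (Finset.mem_singleton_self w) hw, hk, fun c hcw =>
        Nat.lt_succ_iff.1 (hc c hcw)⟩

/-- In a rooted tree with more than `k` vertices, some branches at some vertex `y` have about `k`
vertices in total. -/
lemma exists_cut (h : F.IsRooting S P) {k : ℕ} {w : W} (hw : w ∈ S)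
    (hk : k + 1 ≤ (P.below {w} S).card) :
    ∃ y ∈ P.below {w} S, ∃ J ⊆ P.childrenIn y S,
      k ≤ (P.below J S).card ∧ (P.below J S).card ≤ max k (2 * k - 2) := by
  obtain ⟨y, hy, hky, hc⟩ := h.exists_lowest hw hk
  refine ⟨y, hy, ?_⟩
  have hyS := below_subset _ _ hy
  -- A branch with exactly `k` vertices can be taken alone. Otherwise all branches at `y` have at
  -- most `k - 1` vertices, and a minimal family reaching `k` exceeds a sum of at most `k - 1` by
  -- one such branch: at most `2 * k - 2`.
  by_cases he : ∃ c ∈ P.childrenIn y S, (P.below {c} S).card = k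
  · obtain ⟨c, hc, hck⟩ := he
    exact ⟨{c}, Finset.singleton_subset_iff.2 hc, hck.ge, hck.le.trans (le_max_left _ _)⟩
  · push Not at he
    have h2 := h.card_below hyS
    rw [card_below_eq_sum subset_rfl] at h2
    obtain ⟨J, hJ, h3, h4⟩ := Finset.exists_minimal_sum (P.childrenIn y S)
      (fun c => (P.below {c} S).card) k (by omega)
    refine ⟨J, hJ, ?_, ?_⟩
    · rwa [card_below_eq_sum hJ]
    · rw [card_below_eq_sum hJ]
      rcases J.eq_empty_or_nonempty with rfl | ⟨r, hr⟩
      · simp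
      · have h5 := h4 r hr
        have h6 := Finset.add_sum_erase J (fun c => (P.below {c} S).card) hr
        have h7 := hc r (hJ hr)
        have h8 := he r (hJ hr)
        refine le_trans ?_ (le_max_right _ _)
        omega

/-- A set of between `a` and `a + p` vertices, where `a ≤ 4 * p + 8`, that is the union of `{y}`, of
branches at `u` with at least `p + 2` vertices each, and of a set `R` that is joined to the
remaining vertices only through `y` and possibly through an edge from `r` to `u`. -/
lemma exists_split (h : F.IsRooting S P) {a p : ℕ} (ha : 1 ≤ a) (hap : a ≤ 4 * p + 8)
    (hS : a + 1 ≤ S.card)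
    (hno : ∀ y ∈ S, ∀ K ⊆ S, y ∉ K → P.root ∉ K → F.IsAttached S K y → a ≤ K.card + 1 →
      a + p + 1 < K.card + 1) :
    ∃ u ∈ S, ∃ y ∈ S, ∃ J ⊆ P.childrenIn u S, ∃ R ⊆ S, ∃ r,
      y ∉ P.below J S ∧ y ∉ R ∧ Disjoint (P.below J S) R ∧ u ∉ R ∧ u ≠ y ∧ P.root ∉ R ∧
      P.root ≠ y ∧ (∀ i ∈ J, p + 2 ≤ (P.below {i} S).card) ∧
      a ≤ (P.below J S).card + R.card + 1 ∧ (P.below J S).card + R.card + 1 ≤ a + p ∧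
      (∀ v ∈ R, ∀ v' ∈ S, v' ∉ R → F.Adj v v' → v' = y ∨ (v = r ∧ v' = u)) ∧
      (r ∈ R → (P.below J S).card + 2 ≤ a) := by
  have hS' : a + 1 ≤ (P.below {P.root} S).card := by rwa [below_root]
  obtain ⟨u, hu, hua, hc⟩ := h.exists_lowest h.root_mem hS'
  have huS := below_subset _ _ hu
  -- A branch with exactly `a` vertices would, without its top `c`, be a set of `a - 1` vertices
  -- attached at `c`, which `hno` forbids.
  have hc' : ∀ c ∈ P.childrenIn u S, (P.below {c} S).card + 1 ≤ a := by
    intro c hcu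
    have h1 := hc c hcu
    have hcS := childrenIn_subset _ _ hcu
    have h2 := h.card_below hcS
    by_contra h3
    have := hno c hcS (P.below (P.childrenIn c S) S) (below_subset _ _)
      (notMem_below_of_subset subset_rfl) (root_notMem_below subset_rfl)
      (h.isAttached_below subset_rfl) (by omega)
    omega
  have h2 := h.card_below huS
  rw [card_below_eq_sum subset_rfl] at h2
  obtain ⟨J₀, hJ₀, h3, h4⟩ := Finset.exists_minimal_sum (P.childrenIn u S)
    (fun c => (P.below {c} S).card) a (by omega)
  have hJne : J₀.Nonempty := by
    rw [Finset.nonempty_iff_ne_empty]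
    rintro rfl
    simp at h3
    omega
  obtain ⟨q, hq, hmin⟩ := Finset.exists_min_image J₀ (fun c => (P.below {c} S).card) hJne
  have h5 := h4 q hq
  have h6 := Finset.add_sum_erase J₀ (fun c => (P.below {c} S).card) hq
  have hJ : J₀.erase q ⊆ P.childrenIn u S := (Finset.erase_subset _ _).trans hJ₀
  rw [← card_below_eq_sum hJ] at h5 h6
  rw [← card_below_eq_sum hJ₀] at h3 h6
  -- The branches in `J₀` are attached at `u`, so `hno` forces at least `a + p + 1` vertices there.
  -- Without the smallest branch `q` fewer than `a` remain; hence this branch, and so every other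
  -- one in `J₀`, has at least `p + 2` vertices.
  have hE := hno u huS (P.below J₀ S) (below_subset _ _) (notMem_below_of_subset hJ₀)
    (root_notMem_below hJ₀) (h.isAttached_below hJ₀) (by omega)
  have hqu := hJ₀ hq
  have hqS := childrenIn_subset _ _ hqu
  have hqa := hc' q hqu
  have hge : (P.below {q} S).card ≤ (P.below (J₀.erase q) S).card := by
    have hne : (J₀.erase q).Nonempty := by
      rw [Finset.nonempty_iff_ne_empty]
      intro he
      rw [he, below_empty, Finset.card_empty] at h6
      omega
    obtain ⟨i, hi⟩ := hne
    refine (hmin i (Finset.mem_of_mem_erase hi)).trans (Finset.card_le_card ?_)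
    exact below_mono (Finset.singleton_subset_iff.2 hi) subset_rfl
  have hbig : ∀ i ∈ J₀.erase q, p + 2 ≤ (P.below {i} S).card := by
    intro i hi
    have := hmin i (Finset.mem_of_mem_erase hi)
    omega
  have hdisj : Disjoint (P.below (J₀.erase q) S) (P.below {q} S) := by
    refine disjoint_below (l := P.level u + 1) (fun c hc => level_of_mem_childrenIn (hJ hc)) ?_
      (by simp)
    simpa using level_of_mem_childrenIn hqu
  have hqsub : {q} ⊆ P.childrenIn u S := Finset.singleton_subset_iff.2 hqu
  have huq : u ∉ P.below {q} S := notMem_below_of_subset hqsub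
  have hrq : P.root ∉ P.below {q} S := root_notMem_below hqsub
  -- Write `d` for the size of the branches other than `q`. If `d` is close to `a`, the missing `k =
  -- a - d - 1` vertices are cut from the branch `q`. As `k ≤ p + 2`, the error `2 * k - 2` stays
  -- below `k + p`, up to equality. The vertex `r` is immaterial, so `r = y` is chosen outside `R`.
  by_cases hd : a ≤ (P.below (J₀.erase q) S).card + p + 3
  · obtain ⟨y, hy, K, hK, hK1, hK2⟩ := h.exists_cut
      (k := a - (P.below (J₀.erase q) S).card - 1) hqS (by omega)
    have hyS := below_subset _ _ hy
    have hKq : P.below K S ⊆ P.below {q} S := by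
      intro w hw
      obtain ⟨hwS, c, hc, hwc⟩ := mem_below.1 hw
      have hcy := P.mem_desc_of_mem_children (mem_childrenIn.1 (hK hc)).2
      exact mem_below_singleton.2 ⟨hwS, P.desc_trans hwc
        (P.desc_trans hcy (mem_below_singleton.1 hy).2)⟩
    refine ⟨u, huS, y, hyS, J₀.erase q, hJ, P.below K S, below_subset _ _, y,
      fun hyJ => Finset.disjoint_left.1 hdisj hyJ hy, notMem_below_of_subset hK,
      hdisj.mono_right hKq, fun h => huq (hKq h), ?_, root_notMem_below hK, ?_, hbig, by omega,
      by omega, ?_, ?_⟩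
    · rintro rfl
      exact huq hy
    · rintro rfl
      exact hrq hy
    · intro v hv v' hv' hn hadj
      exact Or.inl (h.isAttached_below hK v hv v' hv' hn hadj)
    · intro hyK
      exact absurd hyK (notMem_below_of_subset hK)
  -- Otherwise nearly the whole branch `q` is needed: the surplus `k` over `a + p` is cut off at
  -- `y`, and `R` is what remains without `y`. The only other exit from `R` is the edge from `r = q`
  -- to `u`. Not too much is removed, since the branch `q` has at most `d` vertices, so `J₀` has at
  -- most `2 * d ≤ 2 * a - 2 * p - 8`, which is at most `a + 2 * p` by `a ≤ 4 * p + 8`.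
  · obtain ⟨y, hy, K, hK, hK1, hK2⟩ := h.exists_cut
      (k := (P.below J₀ S).card - a - p) hqS (by omega)
    have hyS := below_subset _ _ hy
    have hKq : P.below K S ⊆ P.below {q} S := by
      intro w hw
      obtain ⟨hwS, c, hc, hwc⟩ := mem_below.1 hw
      have hcy := P.mem_desc_of_mem_children (mem_childrenIn.1 (hK hc)).2
      exact mem_below_singleton.2 ⟨hwS, P.desc_trans hwc
        (P.desc_trans hcy (mem_below_singleton.1 hy).2)⟩
    have hyK := notMem_below_of_subset hK
    have hRsub : (P.below {q} S \ P.below K S).erase y ⊆ P.below {q} S :=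
      (Finset.erase_subset _ _).trans Finset.sdiff_subset
    have hcard : ((P.below {q} S \ P.below K S).erase y).card + 1 + (P.below K S).card
        = (P.below {q} S).card := by
      rw [Finset.card_erase_add_one (Finset.mem_sdiff.2 ⟨hy, hyK⟩)]
      exact Finset.card_sdiff_add_card_eq_card hKq
    refine ⟨u, huS, y, hyS, J₀.erase q, hJ, (P.below {q} S \ P.below K S).erase y,
      hRsub.trans (below_subset _ _), q,
      fun hyJ => Finset.disjoint_left.1 hdisj hyJ hy, Finset.notMem_erase _ _,
      hdisj.mono_right hRsub, fun h => huq (hRsub h), ?_, fun h => hrq (hRsub h), ?_, hbig,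
      by omega, by omega, ?_, fun _ => by omega⟩
    · rintro rfl
      exact huq hy
    · rintro rfl
      exact hrq hy
    · intro v hv v' hv' hn hadj
      by_cases hvy : v' = y
      · exact Or.inl hvy
      right
      have hvq := hRsub hv
      by_cases hvq' : v' ∈ P.below {q} S
      · exfalso
        have hvK : v' ∈ P.below K S := by
          by_contra hvK
          exact hn (Finset.mem_erase.2 ⟨hvy, Finset.mem_sdiff.2 ⟨hvq', hvK⟩⟩)
        have hv2 := Finset.mem_erase.1 hv
        exact hv2.1 (h.isAttached_below hK v' hvK v (below_subset _ _ hvq)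
          (Finset.mem_sdiff.1 hv2.2).2 hadj.symm)
      · obtain ⟨h7, h8⟩ := h.edge_below hvq hv' hvq' hadj
        exact ⟨h7, h8.trans (mem_childrenIn.1 hqu).2.2⟩

end IsRooting

end SimpleGraph

/-! ### Final segments of the preorder. -/

namespace Finset

variable {V : Type u} [LinearOrder V]

/-- `I` is a final segment of `X`. -/
def IsFinal (I X : Finset V) : Prop := I ⊆ X ∧ ∀ i ∈ I, ∀ x ∈ X, i ≤ x → x ∈ I

namespace IsFinal

lemma empty (X : Finset V) : IsFinal ∅ X := ⟨Finset.empty_subset X, by simp⟩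

/-- Final segments are nested, so inclusion is decided by size. Applied to images of embeddings,
this shows which branches and roots are used from cardinalities alone. -/
lemma subset_of_card_le {I J X : Finset V} (hI : I.IsFinal X) (hJ : J.IsFinal X)
    (h : J.card ≤ I.card) : J ⊆ I := by
  intro j hj
  by_contra hn
  have hlt : ∀ i ∈ I, j < i := fun i hi => by
    by_contra hle
    exact hn (hI.2 i hi j (hJ.1 hj) (not_lt.1 hle))
  have hsub : I ⊆ J := fun i hi => hJ.2 j hj i (hI.1 hi) (hlt i hi).le
  have : I.card < J.card := Finset.card_lt_card ⟨hsub, fun h' => hn (h' hj)⟩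
  omega

lemma union {I J X : Finset V} (hI : I.IsFinal X) (hJ : J.IsFinal (X \ I)) :
    (I ∪ J).IsFinal X := by
  refine ⟨Finset.union_subset hI.1 (hJ.1.trans Finset.sdiff_subset), fun i hi x hx hix => ?_⟩
  rw [Finset.mem_union] at hi ⊢
  by_cases hxI : x ∈ I
  · exact Or.inl hxI
  · rcases hi with hi | hi
    · exact absurd (hI.2 i hi x hx hix) hxI
    · exact Or.inr (hJ.2 i hi x (Finset.mem_sdiff.2 ⟨hx, hxI⟩) hix)

lemma of_card {I X : Finset V} (h : I ⊆ X) (hc : X.card ≤ I.card) : I.IsFinal X := by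
  rw [Finset.eq_of_subset_of_card_le h hc]
  exact ⟨subset_rfl, fun _ _ _ hx _ => hx⟩

lemma lt_of_notMem {I X : Finset V} (hI : I.IsFinal X) {i x : V} (hi : i ∈ I) (hx : x ∈ X)
    (hn : x ∉ I) : x < i := by
  by_contra h
  exact hn (hI.2 i hi x hx (not_lt.1 h))

end IsFinal

/-- The elements of `H` before all elements of `I`. -/
def before (I H : Finset V) : Finset V := H.filter fun w => ∀ i ∈ I, w < i

lemma mem_before {I H : Finset V} {w : V} : w ∈ before I H ↔ w ∈ H ∧ ∀ i ∈ I, w < i := by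
  simp [before]

lemma isLowerSet_before (I : Finset V) {H : Finset V} (hH : IsLowerSet (H : Set V)) :
    IsLowerSet (before I H : Set V) := by
  intro a b hab ha
  rw [Finset.mem_coe, mem_before] at ha ⊢
  exact ⟨hH hab ha.1, fun i hi => hab.trans_lt (ha.2 i hi)⟩

end Finset

namespace DFSTree

open ParentTree Finset

variable {V : Type u} [LinearOrder V] {T : DFSTree V}

/-- After removal of a final segment, the remainder again has the form `T.below A' H'` with `H'` a
lower set, which makes the induction hypothesis applicable to it. -/
lemma below_before {A H I : Finset V} (hH : IsLowerSet (H : Set V))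
    (hI : I.IsFinal (T.below A H)) :
    T.below (A ∩ before I H) (before I H) = T.below A H \ I := by
  ext w
  rw [mem_below, mem_before, Finset.mem_sdiff, mem_below]
  constructor
  · rintro ⟨⟨hw, h1⟩, a, ha, hwa⟩
    exact ⟨⟨hw, a, (Finset.mem_inter.1 ha).1, hwa⟩, fun hwI => lt_irrefl _ (h1 w hwI)⟩
  · rintro ⟨⟨hw, a, ha, hwa⟩, hn⟩
    have hlt : ∀ i ∈ I, w < i := fun i hi => hI.lt_of_notMem hi (mem_below.2 ⟨hw, a, ha, hwa⟩) hn
    exact ⟨⟨hw, hlt⟩, a, Finset.mem_inter.2 ⟨ha, mem_before.2 ⟨mem_of_mem_desc hH hw hwa,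
      fun i hi => (T.le_of_mem_desc hwa).trans_lt (hlt i hi)⟩⟩, hwa⟩

namespace IsRoots

variable {l : ℕ} {A H : Finset V}

lemma inter_lower (hA : T.IsRoots l A) (hH : IsLowerSet (H : Set V)) : T.IsRoots l (A ∩ H) :=
  hA.subset Finset.inter_subset_left fun _ _ _ hb _ hw _ h =>
    Finset.mem_inter.2 ⟨hw, hH h (Finset.mem_inter.1 hb).2⟩

lemma isFinal_below (hA : T.IsRoots l A) {B : Finset V} (hBA : B ⊆ A)
    (hB : ∀ b ∈ B, ∀ a ∈ A, b ≤ a → a ∈ B) : (T.below B H).IsFinal (T.below A H) := by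
  refine ⟨below_mono hBA subset_rfl, fun i hi x hx hix => ?_⟩
  obtain ⟨-, b, hb, hib⟩ := mem_below.1 hi
  obtain ⟨hxH, a, ha, hxa⟩ := mem_below.1 hx
  refine mem_below.2 ⟨hxH, a, hB b hb a ha ?_, hxa⟩
  exact T.le_of_mem_desc_of_le ((hA.level_eq b (hBA hb)).trans (hA.level_eq a ha).symm) hib hxa hix

lemma le_level (hA : T.IsRoots l A) {x : V} (hx : x ∈ T.below A H) : l ≤ T.level x := by
  obtain ⟨-, a, ha, hxa⟩ := mem_below.1 hx
  exact (hA.level_eq a ha).ge.trans (T.level_le_of_mem_desc hxa)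

lemma mem_of_level_le (hA : T.IsRoots l A) {x : V} (hx : x ∈ T.below A H) (hl : T.level x ≤ l) :
    x ∈ A := by
  obtain ⟨-, a, ha, hxa⟩ := mem_below.1 hx
  rwa [T.eq_of_mem_desc hxa (hl.trans (hA.level_eq a ha).ge)]

lemma isNearestLeftCousin (hA : T.IsRoots l A) {p v : V} (hp : p ∈ A) (hv : v ∈ A) (hpv : p < v)
    (h : ∀ w ∈ A, w < v → w ≤ p) : T.IsNearestLeftCousin p v := by
  refine ⟨⟨(hA.level_eq p hp).trans (hA.level_eq v hv).symm, hpv⟩, fun w hw => ?_⟩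
  by_contra hlt
  have hlt := not_le.1 hlt
  exact hlt.not_ge (h w (hA.convex p hp v hv w (hw.1.trans (hA.level_eq v hv)) hlt.le hw.2.le) hw.2)

lemma card_below_erase (hA : T.IsRoots l A) {a : V} (ha : a ∈ A) :
    (T.below (A.erase a) H).card + (T.below {a} H).card = (T.below A H).card := by
  rw [← card_below_union (l := l), Finset.union_comm, ← Finset.insert_eq, Finset.insert_erase ha]
  · exact fun b hb => hA.level_eq b (Finset.mem_of_mem_erase hb)
  · simpa using hA.level_eq a ha
  · simp

/-- A root is adjacent to all vertices of the branches before it. -/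
lemma adj_of_mem_below (hA : T.IsRoots l A) {a x : V} (ha : a ∈ A) (hx : x ∈ T.below A H)
    (hlt : x < a) : (T.generated 2).Adj a x := by
  obtain ⟨-, b, hb, hxb⟩ := mem_below.1 hx
  exact hA.adj_of_lt b hb a ha ((T.le_of_mem_desc hxb).trans_lt hlt) x hxb

lemma adj_of_level_le (hA : T.IsRoots l A) {x y : V} (hx : x ∈ T.below A H) (hy : y ∈ T.below A H)
    (hlx : T.level x ≤ l + 1) (hly : T.level y ≤ l + 1) (hne : x ≠ y) :
    (T.generated 2).Adj x y := by
  obtain ⟨-, a, ha, hxa⟩ := mem_below.1 hx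
  obtain ⟨-, b, hb, hyb⟩ := mem_below.1 hy
  exact hA.adj_of_level a ha b hb x hxa y hyb hlx hly hne

end IsRoots

/-- The two right-most branches without their roots. -/
lemma below_pair {H : Finset V} (hH : IsLowerSet (H : Set V)) {p v : V} (hp : p ∈ H) (hv : v ∈ H) :
    T.below {p, v} H =
      insert p (insert v (T.below (T.childrenIn p H ∪ T.childrenIn v H) H)) := by
  rw [Finset.insert_eq, below_union, below_singleton hH hp, below_singleton hH hv, below_union]
  ext w
  simp only [Finset.mem_union, Finset.mem_insert]
  tauto

lemma disjoint_childrenIn {H : Finset V} {p v : V} (hne : p ≠ v) :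
    Disjoint (T.childrenIn p H) (T.childrenIn v H) := by
  rw [Finset.disjoint_left]
  intro c h1 h2
  exact hne ((mem_childrenIn.1 h1).2.2.symm.trans (mem_childrenIn.1 h2).2.2)

lemma card_below_childrenIn_union {H : Finset V} (hH : IsLowerSet (H : Set V)) {p v : V}
    (hp : p ∈ H) (hv : v ∈ H) (hne : p ≠ v) (hl : T.level p = T.level v) :
    (T.below (T.childrenIn p H ∪ T.childrenIn v H) H).card + 2 =
      (T.below {p} H).card + (T.below {v} H).card := by
  rw [card_below hH hp, card_below hH hv, card_below_union (l := T.level v + 1)]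
  · omega
  · exact fun a ha => by rw [level_of_mem_childrenIn ha, hl]
  · exact fun a ha => level_of_mem_childrenIn ha
  · exact disjoint_childrenIn hne

lemma mem_below_childrenIn_union {H : Finset V} {p v w : V}
    (hw : w ∈ T.below (T.childrenIn p H ∪ T.childrenIn v H) H) :
    w ∈ H ∧ ((w ∈ T.desc p ∧ w ≠ p) ∨ (w ∈ T.desc v ∧ w ≠ v)) := by
  rw [below_union, Finset.mem_union] at hw
  rcases hw with hw | hw
  · obtain ⟨h1, c, hc, hwc⟩ := mem_below.1 hw
    refine ⟨h1, Or.inl ⟨T.desc_trans hwc (T.mem_desc_of_mem_children (mem_childrenIn.1 hc).2), ?_⟩⟩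
    rintro rfl
    exact notMem_below_childrenIn w H hw
  · obtain ⟨h1, c, hc, hwc⟩ := mem_below.1 hw
    refine ⟨h1, Or.inr ⟨T.desc_trans hwc (T.mem_desc_of_mem_children (mem_childrenIn.1 hc).2), ?_⟩⟩
    rintro rfl
    exact notMem_below_childrenIn w H hw

/-- A final segment of the two right-most branches without their roots `p` and `v`, together with
`v`, is a final segment if it is large enough. -/
lemma IsRoots.isFinal_insert {l : ℕ} {A H I : Finset V} (hA : T.IsRoots l A)
    (hH : IsLowerSet (H : Set V)) (hAH : A ⊆ H) {p v : V} (hp : p ∈ A) (hv : v ∈ A)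
    (hpv : p < v) (hpA : ∀ w ∈ A, w < v → w ≤ p) (hvA : ∀ w ∈ A, w ≤ v)
    (hI : I.IsFinal (T.below (T.childrenIn p H ∪ T.childrenIn v H) H))
    (hc : (T.below {v} H).card ≤ I.card + 1) : (insert v I).IsFinal (T.below A H) := by
  have hlp := hA.level_eq p hp
  have hlv := hA.level_eq v hv
  have hcous := hA.isNearestLeftCousin hp hv hpv hpA
  have hsub : T.below {p, v} H ⊆ T.below A H :=
    below_mono (by simp [Finset.insert_subset_iff, hp, hv]) subset_rfl
  rw [below_pair hH (hAH hp) (hAH hv)] at hsub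
  -- The proper descendants of `v` form a final segment no larger than `I`, so `I` contains all of
  -- them and adding `v` leaves no gap to its right.
  have hdv : T.below (T.childrenIn v H) H ⊆ I := by
    refine hI.subset_of_card_le ((isRoots_childrenIn_union hH hcous).isFinal_below
      Finset.subset_union_right ?_) ?_
    · intro b hb a ha hba
      rcases Finset.mem_union.1 ha with ha | ha
      · exfalso
        have h1 := mem_childrenIn.1 hb
        have h2 := mem_childrenIn.1 ha
        have := T.desc_lt_desc (hlp.trans hlv.symm) hpv (T.mem_desc_of_mem_children h2.2)
          (T.mem_desc_of_mem_children h1.2)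
        exact absurd hba (not_le.2 this)
      · exact ha
    · rw [card_below hH (hAH hv)] at hc
      omega
  refine ⟨?_, ?_⟩
  · intro x hx
    apply hsub
    rcases Finset.mem_insert.1 hx with rfl | hx
    · simp
    · simp [hI.1 hx]
  · intro i hi x hx hix
    have hpi : p < i := by
      rcases Finset.mem_insert.1 hi with rfl | hi
      · exact hpv
      · obtain ⟨-, ⟨h1, h2⟩ | ⟨h1, h2⟩⟩ := mem_below_childrenIn_union (hI.1 hi)
        · exact T.lt_of_mem_desc h1 h2
        · exact T.desc_lt_desc (hlp.trans hlv.symm) hpv (T.mem_desc_self p) h1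
    obtain ⟨hxH, a, ha, hxa⟩ := mem_below.1 hx
    have hpa : p ≤ a := T.le_of_mem_desc_of_le (hlp.trans (hA.level_eq a ha).symm)
      (T.mem_desc_self p) hxa (hpi.le.trans hix)
    have hapv : a = p ∨ a = v := by
      rcases (hvA a ha).eq_or_lt with h | h
      · exact Or.inr h
      · exact Or.inl (le_antisymm (hpA a ha h) hpa)
    have hx' : x ∈ T.below {p, v} H := mem_below.2 ⟨hxH, a, by simpa using hapv, hxa⟩
    rw [below_pair hH (hAH hp) (hAH hv), Finset.mem_insert, Finset.mem_insert] at hx'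
    rw [Finset.mem_insert]
    rcases hx' with rfl | h | hx'
    · exact absurd (hpi.trans_le hix) (lt_irrefl _)
    · exact Or.inl h
    · rcases Finset.mem_insert.1 hi with rfl | hi
      · right
        have hav : x ∈ T.desc i := by
          rcases hapv with rfl | rfl
          · exact absurd (T.desc_lt_desc (hlp.trans hlv.symm) hpv hxa (T.mem_desc_self i))
              (not_lt.2 hix)
          · exact hxa
        have : x ∈ T.below {i} H := mem_below_singleton.2 ⟨hxH, hav⟩
        rw [below_singleton hH (hAH hv), Finset.mem_insert] at this
        rcases this with rfl | h
        · obtain ⟨-, ⟨h1, h2⟩ | ⟨h1, h2⟩⟩ := mem_below_childrenIn_union hx'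
          · exact absurd (T.desc_lt_desc (hlp.trans hlv.symm) hpv h1 (T.mem_desc_self x))
              (lt_irrefl _)
          · exact absurd rfl h2
        · exact hdv h
      · exact Or.inr (hI.2 i hi x hx' hix)

end DFSTree

/-! ### Gluing partial embeddings. -/

namespace SimpleGraph

variable {V : Type u} {W : Type v} [DecidableEq W] {F : SimpleGraph W} {G : SimpleGraph V}

/-- `φ` embeds the part of `F` in `S` into `G`. -/
def IsEmbOn (F : SimpleGraph W) (G : SimpleGraph V) (S : Finset W) (φ : W → V) : Prop :=
  Set.InjOn φ S ∧ ∀ u ∈ S, ∀ v ∈ S, F.Adj u v → G.Adj (φ u) (φ v)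

namespace IsEmbOn

variable [DecidableEq V]

lemma card_image {S : Finset W} {φ : W → V} (h : F.IsEmbOn G S φ) : (S.image φ).card = S.card :=
  Finset.card_image_of_injOn h.1

lemma exists_union {S₁ S₂ : Finset W} {φ₁ φ₂ : W → V} (h₁ : F.IsEmbOn G S₁ φ₁)
    (h₂ : F.IsEmbOn G S₂ φ₂) (hd : Disjoint S₁ S₂) (hi : Disjoint (S₁.image φ₁) (S₂.image φ₂))
    (hadj : ∀ u ∈ S₁, ∀ v ∈ S₂, F.Adj u v → G.Adj (φ₁ u) (φ₂ v)) :
    ∃ φ : W → V, F.IsEmbOn G (S₁ ∪ S₂) φ ∧ (∀ w ∈ S₁, φ w = φ₁ w) ∧ (∀ w ∈ S₂, φ w = φ₂ w) ∧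
      (S₁ ∪ S₂).image φ = S₁.image φ₁ ∪ S₂.image φ₂ := by
  have e₁ : ∀ w ∈ S₁, (fun w => if w ∈ S₁ then φ₁ w else φ₂ w) w = φ₁ w := fun w hw => if_pos hw
  have e₂ : ∀ w ∈ S₂, (fun w => if w ∈ S₁ then φ₁ w else φ₂ w) w = φ₂ w := fun w hw =>
    if_neg (Finset.disjoint_right.1 hd hw)
  generalize (fun w => if w ∈ S₁ then φ₁ w else φ₂ w) = φ at e₁ e₂
  have hne : ∀ u ∈ S₁, ∀ v ∈ S₂, φ₁ u ≠ φ₂ v := fun u hu v hv he =>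
    Finset.disjoint_left.1 hi (Finset.mem_image_of_mem φ₁ hu) (he ▸ Finset.mem_image_of_mem φ₂ hv)
  refine ⟨φ, ⟨?_, ?_⟩, e₁, e₂, ?_⟩
  · intro u hu v hv huv
    rw [Finset.mem_coe, Finset.mem_union] at hu hv
    rcases hu with hu | hu <;> rcases hv with hv | hv
    · rw [e₁ u hu, e₁ v hv] at huv
      exact h₁.1 hu hv huv
    · rw [e₁ u hu, e₂ v hv] at huv
      exact absurd huv (hne u hu v hv)
    · rw [e₂ u hu, e₁ v hv] at huv
      exact absurd huv.symm (hne v hv u hu)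
    · rw [e₂ u hu, e₂ v hv] at huv
      exact h₂.1 hu hv huv
  · intro u hu v hv huv
    rw [Finset.mem_union] at hu hv
    rcases hu with hu | hu <;> rcases hv with hv | hv
    · rw [e₁ u hu, e₁ v hv]
      exact h₁.2 u hu v hv huv
    · rw [e₁ u hu, e₂ v hv]
      exact hadj u hu v hv huv
    · rw [e₂ u hu, e₁ v hv]
      exact (hadj v hv u hu huv.symm).symm
    · rw [e₂ u hu, e₂ v hv]
      exact h₂.2 u hu v hv huv
  · rw [Finset.image_union, Finset.image_congr e₁, Finset.image_congr e₂]

lemma exists_insert {S : Finset W} {φ₀ : W → V} {x : W} {a : V} (hx : x ∈ S)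
    (h : F.IsEmbOn G (S.erase x) φ₀) (ha : a ∉ (S.erase x).image φ₀)
    (hadj : ∀ w ∈ S.erase x, F.Adj x w → G.Adj a (φ₀ w)) :
    ∃ φ : W → V, F.IsEmbOn G S φ ∧ φ x = a ∧ (∀ w ∈ S.erase x, φ w = φ₀ w) ∧
      S.image φ = insert a ((S.erase x).image φ₀) := by
  have h₁ : F.IsEmbOn G {x} (fun _ => a) := by
    refine ⟨by simp, fun u hu v hv huv => ?_⟩
    rw [Finset.mem_singleton.1 hu, Finset.mem_singleton.1 hv] at huv
    exact absurd huv (F.loopless.irrefl x)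
  obtain ⟨φ, h2, h3, h4, h5⟩ := h₁.exists_union h (by simp) (by simpa using ha) (by simpa using hadj)
  rw [← Finset.insert_eq, Finset.insert_erase hx] at h2
  rw [← Finset.insert_eq, Finset.insert_erase hx, Finset.image_singleton, ← Finset.insert_eq] at h5
  exact ⟨φ, h2, h3 x (Finset.mem_singleton_self x), h4, h5⟩

end IsEmbOn

end SimpleGraph

/-! ### The inductive statement, and the cases of one and two branches. -/

namespace DFSTree

open ParentTree Finset SimpleGraph

variable {V : Type u} [LinearOrder V] {W : Type v} [DecidableEq W]

/-- The inductive form of the embedding theorem, for instances of size at most `N`. -/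
def Embeds (T : DFSTree V) (F : SimpleGraph W) (N : ℕ) : Prop :=
  ∀ (l : ℕ) (A H : Finset V) (S : Finset W) (x₁ x₂ : W), T.IsRoots l A → IsLowerSet (H : Set V) →
    A ⊆ H → x₁ ∈ S → x₂ ∈ S → S.card + (T.below A H).card ≤ N → S.card ≤ (T.below A H).card →
    ∃ φ : W → V, F.IsEmbOn (T.generated 2) S φ ∧ (S.image φ).IsFinal (T.below A H) ∧
      (∀ y ∈ S, T.level (φ x₁) ≤ T.level (φ y)) ∧
      ∀ v₁ v₂ : V, A = {v₁, v₂} → v₁ < v₂ → 2 ≤ (T.below {v₂} H).card →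
        (T.below {v₂} H).card ≤ S.card → S.card + 1 ≤ (T.below A H).card →
        T.level (φ x₂) ≤ l + 1

namespace Embeds

variable {T : DFSTree V} {F : SimpleGraph W} {N l : ℕ} {A H : Finset V} {S : Finset W}

lemma exists_emb (h : T.Embeds F N) (hA : T.IsRoots l A) (hH : IsLowerSet (H : Set V))
    (hAH : A ⊆ H) (hN : S.card + (T.below A H).card ≤ N) (hS : S.card ≤ (T.below A H).card) :
    ∃ φ : W → V, F.IsEmbOn (T.generated 2) S φ ∧ (S.image φ).IsFinal (T.below A H) := by
  rcases S.eq_empty_or_nonempty with rfl | ⟨x, hx⟩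
  · exact ⟨fun _ => T.root, ⟨by simp, by simp⟩, by simpa using Finset.IsFinal.empty _⟩
  · obtain ⟨φ, h1, h2, -⟩ := h l A H S x x hA hH hAH hx hx hN hS
    exact ⟨φ, h1, h2⟩

/-- An embedding in which the given vertex, if it is to be embedded, is mapped to a root. -/
lemma exists_emb_root (h : T.Embeds F N) (hA : T.IsRoots l A) (hH : IsLowerSet (H : Set V))
    (hAH : A ⊆ H) (hN : S.card + (T.below A H).card ≤ N) (hS : S.card ≤ (T.below A H).card)
    (x : W) {J : Finset V} (hJ : J.IsFinal (T.below A H)) (hJS : J.card ≤ S.card)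
    (hJA : x ∈ S → ∃ a ∈ A, a ∈ J) :
    ∃ φ : W → V, F.IsEmbOn (T.generated 2) S φ ∧ (S.image φ).IsFinal (T.below A H) ∧
      (x ∈ S → φ x ∈ A) := by
  by_cases hx : x ∈ S
  · obtain ⟨φ, h1, h2, h3, -⟩ := h l A H S x x hA hH hAH hx hx hN hS
    refine ⟨φ, h1, h2, fun _ => ?_⟩
    obtain ⟨a, haA, haJ⟩ := hJA hx
    -- The image contains `J`, hence a root; having minimal level, the image of `x` is then itself
    -- on level `l`.
    have hJ' := h2.subset_of_card_le hJ (by rw [h1.card_image]; exact hJS)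
    obtain ⟨w, hw, hwa⟩ := Finset.mem_image.1 (hJ' haJ)
    refine hA.mem_of_level_le (h2.1 (Finset.mem_image_of_mem φ hx)) ?_
    rw [← hA.level_eq a haA, ← hwa]
    exact h3 w hw
  · obtain ⟨φ, h1, h2⟩ := h.exists_emb hA hH hAH hN hS
    exact ⟨φ, h1, h2, fun h => absurd h hx⟩

end Embeds

variable {T : DFSTree V} {F : SimpleGraph W} {N l : ℕ} {A H : Finset V} {S : Finset W}

/-- The induction step for a single branch. -/
lemma Embeds.step_one (h : T.Embeds F N) {v : V} (hA : T.IsRoots l {v})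
    (hH : IsLowerSet (H : Set V)) (hv : v ∈ H) {x₁ : W} (hx₁ : x₁ ∈ S)
    (hN : S.card + (T.below {v} H).card ≤ N + 1) (hS : S.card ≤ (T.below {v} H).card) :
    ∃ φ : W → V, F.IsEmbOn (T.generated 2) S φ ∧ (S.image φ).IsFinal (T.below {v} H) ∧
      (∀ y ∈ S, T.level (φ x₁) ≤ T.level (φ y)) := by
  have hlv : T.level v = l := hA.level_eq v (by simp)
  have hX := below_singleton (T := T) hH hv
  have hc := card_below (T := T) hH hv
  have hR : T.IsRoots (l + 1) (T.childrenIn v H) := hlv ▸ isRoots_childrenIn hH v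
  -- The top `v` is first in its branch, so it is needed only if the whole branch is filled; in that
  -- case it receives `x₁`, being adjacent to all its descendants.
  by_cases hlt : S.card < (T.below {v} H).card
  · obtain ⟨φ, h1, h2, h3, -⟩ := h (l + 1) (T.childrenIn v H) H S x₁ x₁ hR hH
      (childrenIn_subset _ _) hx₁ hx₁ (by omega) (by omega)
    refine ⟨φ, h1, ⟨?_, ?_⟩, h3⟩
    · rw [hX]
      exact h2.1.trans (Finset.subset_insert _ _)
    · intro i hi x hx hix
      rw [hX, Finset.mem_insert] at hx
      rcases hx with rfl | hx
      · have hi' : i ∈ T.below {x} H := by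
          rw [hX]
          exact Finset.mem_insert_of_mem (h2.1 hi)
        have := T.le_of_mem_desc (mem_below_singleton.1 hi').2
        rwa [le_antisymm this hix]
      · exact h2.2 i hi x hx hix
  · have hcS := Finset.card_erase_add_one hx₁
    obtain ⟨φ₀, h1, h2⟩ := h.exists_emb (S := S.erase x₁) hR hH (childrenIn_subset _ _)
      (by omega) (by omega)
    have hmem : ∀ w ∈ S.erase x₁, φ₀ w ∈ T.desc v ∧ φ₀ w ≠ v := by
      intro w hw
      have h3 := h2.1 (Finset.mem_image_of_mem φ₀ hw)
      have h4 : φ₀ w ∈ T.below {v} H := by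
        rw [hX]
        exact Finset.mem_insert_of_mem h3
      refine ⟨(mem_below_singleton.1 h4).2, fun he => ?_⟩
      rw [he] at h3
      exact notMem_below_childrenIn v H h3
    obtain ⟨φ, h3, h4, h5, h6⟩ := h1.exists_insert (a := v) hx₁
      (fun hv => notMem_below_childrenIn v H (h2.1 hv))
      (fun w hw _ => adj_desc (hmem w hw).2 (hmem w hw).1)
    have hsub : S.image φ ⊆ T.below {v} H := by
      rw [h6, hX]
      exact Finset.insert_subset_insert _ h2.1
    refine ⟨φ, h3, .of_card hsub (by rw [h3.card_image]; omega), fun y hy => ?_⟩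
    rw [h4, hlv]
    exact hA.le_level (hsub (Finset.mem_image_of_mem φ hy))

/-- The induction step for two branches the right one of which is to be filled. -/
lemma Embeds.step_two (h : T.Embeds F N) (hF : F.IsAcyclic) {v₁ v₂ : V} (hlt : v₁ < v₂) (hA : T.IsRoots l {v₁, v₂})
    (hH : IsLowerSet (H : Set V)) (h₁ : v₁ ∈ H) (h₂ : v₂ ∈ H) {x₁ x₂ : W} (hx₁ : x₁ ∈ S)
    (hx₂ : x₂ ∈ S) (hN : S.card + (T.below {v₁, v₂} H).card ≤ N + 1)
    (hS : S.card ≤ (T.below {v₁, v₂} H).card) (hge : (T.below {v₂} H).card ≤ S.card) :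
    ∃ φ : W → V, F.IsEmbOn (T.generated 2) S φ ∧ (S.image φ).IsFinal (T.below {v₁, v₂} H) ∧
      (∀ y ∈ S, T.level (φ x₁) ≤ T.level (φ y)) ∧
      (2 ≤ (T.below {v₂} H).card → S.card + 1 ≤ (T.below {v₁, v₂} H).card →
        T.level (φ x₂) ≤ l + 1) := by
  have hl₁ : T.level v₁ = l := hA.level_eq v₁ (by simp)
  have hl₂ : T.level v₂ = l := hA.level_eq v₂ (by simp)
  have hAH : {v₁, v₂} ⊆ H := by simp [Finset.insert_subset_iff, h₁, h₂]
  have hcous : T.IsNearestLeftCousin v₁ v₂ := hA.isNearestLeftCousin (by simp) (by simp) hlt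
    (by simp only [Finset.mem_insert, Finset.mem_singleton]
        rintro w (rfl | rfl) hw
        · exact le_rfl
        · exact absurd hw (lt_irrefl _))
  have hR : T.IsRoots (l + 1) (T.childrenIn v₁ H ∪ T.childrenIn v₂ H) :=
    hl₂ ▸ isRoots_childrenIn_union hH hcous
  have hRH : T.childrenIn v₁ H ∪ T.childrenIn v₂ H ⊆ H :=
    Finset.union_subset (childrenIn_subset _ _) (childrenIn_subset _ _)
  have hX := below_pair (T := T) hH h₁ h₂
  have hc := card_below_childrenIn_union hH h₁ h₂ hlt.ne (hl₁.trans hl₂.symm)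
  have hcX : (T.below {v₁, v₂} H).card = (T.below {v₁} H).card + (T.below {v₂} H).card := by
    have := hA.card_below_erase (H := H) (a := v₁) (by simp)
    rw [Finset.erase_insert (by simpa using hlt.ne)] at this
    omega
  have hcS := Finset.card_erase_add_one hx₁
  have hsub0 : T.below (T.childrenIn v₁ H ∪ T.childrenIn v₂ H) H ⊆ T.below {v₁, v₂} H := by
    rw [hX]
    exact (Finset.subset_insert _ _).trans (Finset.subset_insert _ _)
  have hlev0 : ∀ w ∈ T.below (T.childrenIn v₁ H ∪ T.childrenIn v₂ H) H, l + 1 ≤ T.level w :=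
    fun w hw => hR.le_level hw
  have hne₁ : ∀ w ∈ T.below (T.childrenIn v₁ H ∪ T.childrenIn v₂ H) H, w ≠ v₁ := by
    rintro w hw rfl
    have := hlev0 w hw
    omega
  have hne₂ : ∀ w ∈ T.below (T.childrenIn v₁ H ∪ T.childrenIn v₂ H) H, w ≠ v₂ := by
    rintro w hw rfl
    have := hlev0 w hw
    omega
  have hadj₂ : ∀ w ∈ T.below {v₁, v₂} H, w ≠ v₂ → (T.generated 2).Adj v₂ w := by
    intro w hw hne
    obtain ⟨-, a, ha, hwa⟩ := mem_below.1 hw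
    rcases Finset.mem_insert.1 ha with rfl | ha
    · exact hA.adj_of_lt a (by simp) v₂ (by simp) hlt w hwa
    · rw [Finset.mem_singleton.1 ha] at hwa
      exact adj_desc hne hwa
  have hpos : 1 ≤ (T.below {v₁} H).card :=
    Finset.card_pos.2 ⟨v₁, self_mem_below (Finset.mem_singleton_self _) h₁⟩
  -- In both cases `x₁` goes to `v₂`, which is adjacent to everything in the two branches. If a
  -- vertex is left over, `v₁` is left free. The remaining vertices of `S` then cover all proper
  -- descendants of `v₂`; if there are any, a child of `v₂` is used, which forces `x₂` onto a child.
  by_cases hfull : S.card + 1 ≤ (T.below {v₁, v₂} H).card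
  · have : ∃ φ₀ : W → V, F.IsEmbOn (T.generated 2) (S.erase x₁) φ₀ ∧
        ((S.erase x₁).image φ₀).IsFinal
          (T.below (T.childrenIn v₁ H ∪ T.childrenIn v₂ H) H) ∧
        (2 ≤ (T.below {v₂} H).card → x₂ ∈ S.erase x₁ →
          φ₀ x₂ ∈ T.childrenIn v₁ H ∪ T.childrenIn v₂ H) := by
      by_cases h2 : 2 ≤ (T.below {v₂} H).card
      · have hcv := card_below (T := T) hH h₂
        obtain ⟨φ₀, h3, h4, h5⟩ := h.exists_emb_root (S := S.erase x₁)
          (J := T.below (T.childrenIn v₂ H) H) hR hH hRH (by omega) (by omega) x₂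
          (hR.isFinal_below Finset.subset_union_right fun b hb a ha hba => by
            rcases Finset.mem_union.1 ha with ha | ha
            · exact absurd hba (not_le.2 (T.desc_lt_desc (hl₁.trans hl₂.symm) hlt
                (T.mem_desc_of_mem_children (mem_childrenIn.1 ha).2)
                (T.mem_desc_of_mem_children (mem_childrenIn.1 hb).2)))
            · exact ha) (by omega)
          (fun _ => by
            obtain ⟨w, hw⟩ := Finset.card_pos.1
              (by omega : 0 < (T.below (T.childrenIn v₂ H) H).card)
            obtain ⟨-, c, hc, -⟩ := mem_below.1 hw
            exact ⟨c, Finset.mem_union_right _ hc, self_mem_below hc (childrenIn_subset _ _ hc)⟩)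
        exact ⟨φ₀, h3, h4, fun _ => h5⟩
      · obtain ⟨φ₀, h3, h4⟩ := h.exists_emb (S := S.erase x₁) hR hH hRH (by omega) (by omega)
        exact ⟨φ₀, h3, h4, fun h => absurd h h2⟩
    obtain ⟨φ₀, h3, h4, h5⟩ := this
    obtain ⟨φ, h6, h7, h8, h9⟩ := h3.exists_insert (a := v₂) hx₁ (fun hv => hne₂ _ (h4.1 hv) rfl)
      (fun w hw _ => hadj₂ _ (hsub0 (h4.1 (Finset.mem_image_of_mem φ₀ hw)))
        (hne₂ _ (h4.1 (Finset.mem_image_of_mem φ₀ hw))))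
    have hfin : (S.image φ).IsFinal (T.below {v₁, v₂} H) := by
      rw [h9]
      refine hA.isFinal_insert hH hAH (p := v₁) (by simp) (by simp) hlt ?_ ?_ h4 ?_
      · simp only [Finset.mem_insert, Finset.mem_singleton]
        rintro w (rfl | rfl) hw
        · exact le_rfl
        · exact absurd hw (lt_irrefl _)
      · simp only [Finset.mem_insert, Finset.mem_singleton]
        rintro w (rfl | rfl)
        · exact hlt.le
        · exact le_rfl
      · rw [h3.card_image]
        omega
    refine ⟨φ, h6, hfin, fun y hy => ?_, fun h2 _ => ?_⟩
    · rw [h7, hl₂]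
      exact hA.le_level (hfin.1 (Finset.mem_image_of_mem φ hy))
    · by_cases he : x₂ = x₁
      · rw [he, h7, hl₂]
        omega
      · have hx := Finset.mem_erase.2 ⟨he, hx₂⟩
        rw [h8 x₂ hx, hR.level_eq _ (h5 h2 hx)]
  -- Now `v₁` must be used too, but its adjacency to the branch of `v₂` is guaranteed only up to
  -- level `l + 1`. It receives a leaf `z` of the forest without `x₁`, and the neighbour `q` of `z`
  -- is directed to level `l + 1`.
  · have : ∃ z ∈ S.erase x₁, ∃ q, ∀ w ∈ (S.erase x₁).erase z, F.Adj z w → w = q := by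
      obtain ⟨z, hz⟩ := Finset.card_pos.1 (by omega : 0 < (S.erase x₁).card)
      by_cases hz' : ∃ w ∈ S.erase x₁, w ≠ z
      · obtain ⟨w, hw, -, q, -, -, hq⟩ := hF.exists_leaf hz hz'
        exact ⟨w, hw, q, fun v hv => hq v (Finset.mem_of_mem_erase hv)⟩
      · push Not at hz'
        refine ⟨z, hz, z, fun w hw _ => hz' w (Finset.mem_of_mem_erase hw)⟩
    obtain ⟨z, hz, q, hq⟩ := this
    have hcz := Finset.card_erase_add_one hz
    obtain ⟨φ₀, h1, h2, h3⟩ := h.exists_emb_root (S := (S.erase x₁).erase z)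
      (J := T.below (T.childrenIn v₁ H ∪ T.childrenIn v₂ H) H) hR hH hRH (by omega) (by omega) q
      (.of_card subset_rfl le_rfl) (by omega)
      (fun hqm => by
        have := Finset.card_pos.2 ⟨q, hqm⟩
        obtain ⟨w, hw⟩ := Finset.card_pos.1
          (by omega : 0 < (T.below (T.childrenIn v₁ H ∪ T.childrenIn v₂ H) H).card)
        obtain ⟨-, c, hc, -⟩ := mem_below.1 hw
        exact ⟨c, hc, self_mem_below hc (hRH hc)⟩)
    obtain ⟨φ₁, h4, h5, h6, h7⟩ := h1.exists_insert (a := v₁) hz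
      (fun hv => hne₁ _ (h2.1 hv) rfl)
      (fun w hw hzw => by
        have hwm := h2.1 (Finset.mem_image_of_mem φ₀ hw)
        refine hA.adj_of_level_le (H := H) (self_mem_below (by simp) h₁) (hsub0 hwm) (by omega) ?_
          (hne₁ _ hwm).symm
        obtain rfl := hq w hw hzw
        rw [hR.level_eq _ (h3 hw)])
    have hsub : (S.erase x₁).image φ₁ ⊆ T.below {v₁, v₂} H := by
      rw [h7]
      exact Finset.insert_subset (self_mem_below (by simp) h₁) (h2.1.trans hsub0)
    have hne : ∀ w ∈ (S.erase x₁).image φ₁, w ≠ v₂ := by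
      intro w hw
      rw [h7, Finset.mem_insert] at hw
      rcases hw with rfl | hw
      · exact hlt.ne
      · exact hne₂ w (h2.1 hw)
    obtain ⟨φ, h8, h9, -, h10⟩ := h4.exists_insert (a := v₂) hx₁ (fun hv => hne _ hv rfl)
      (fun w hw _ => hadj₂ _ (hsub (Finset.mem_image_of_mem φ₁ hw))
        (hne _ (Finset.mem_image_of_mem φ₁ hw)))
    have hsub' : S.image φ ⊆ T.below {v₁, v₂} H := by
      rw [h10]
      exact Finset.insert_subset (self_mem_below (by simp) h₂) hsub
    refine ⟨φ, h8, .of_card hsub' (by rw [h8.card_image]; omega), fun y hy => ?_,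
      fun _ h => absurd h hfull⟩
    rw [h9, hl₂]
    exact hA.le_level (hsub' (Finset.mem_image_of_mem φ hy))

end DFSTree

lemma Finset.IsFinal.trans {V : Type u} [LinearOrder V] {I J X : Finset V} (hI : I.IsFinal J)
    (hJ : J.IsFinal X) : I.IsFinal X :=
  ⟨hI.1.trans hJ.1, fun i hi x hx hix => hI.2 i hi x (hJ.2 i (hI.1 hi) x hx hix) hix⟩

/-! ### Cutting at one vertex, and filling branches with large pieces. -/

namespace DFSTree

open ParentTree Finset SimpleGraph

variable {V : Type u} [LinearOrder V] {W : Type v} [DecidableEq W]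
  {T : DFSTree V} {F : SimpleGraph W} {N l : ℕ} {A H : Finset V} {S : Finset W}

/-- Embedding into the part of the tree that is left by a final segment `I`. -/
lemma Embeds.exists_emb_rest (h : T.Embeds F N) (hA : T.IsRoots l A) (hH : IsLowerSet (H : Set V))
    {I : Finset V} (hI : I.IsFinal (T.below A H))
    (hN : S.card + (T.below A H).card ≤ N + I.card)
    (hS : S.card + I.card ≤ (T.below A H).card) (x : W) {A' : Finset V} (hA'A : A' ⊆ A)
    (hA' : ∀ b ∈ A', ∀ a ∈ A, b ≤ a → a ∈ A')
    (hx : x ∈ S → I.card < (T.below A' H).card ∧ (T.below A' H).card ≤ S.card + I.card) :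
    ∃ φ : W → V, F.IsEmbOn (T.generated 2) S φ ∧ (S.image φ).IsFinal (T.below A H \ I) ∧
      (x ∈ S → φ x ∈ A) := by
  have hR : T.IsRoots l (A ∩ before I H) := hA.inter_lower (isLowerSet_before I hH)
  have hX := below_before hH hI
  have hc := Finset.card_sdiff_add_card_eq_card hI.1
  rw [← hX] at hc ⊢
  by_cases hxS : x ∈ S
  · obtain ⟨h1, h2⟩ := hx hxS
    have hfin : (T.below A' H).IsFinal (T.below A H) := hA.isFinal_below hA'A hA'
    have hsub : I ⊆ T.below A' H := hfin.subset_of_card_le hI h1.le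
    have hc' := Finset.card_sdiff_add_card_eq_card hsub
    -- The branches at `A'` are not exhausted by `I` but are by `I` and `S` together. Their unused
    -- part starts with a root, which is therefore covered.
    obtain ⟨φ, h3, h4, h5⟩ := h.exists_emb_root (S := S) (J := T.below A' H \ I) hR
      (isLowerSet_before I hH) Finset.inter_subset_right (by omega) (by omega) x
      (by
        rw [hX]
        refine ⟨Finset.sdiff_subset_sdiff hfin.1 subset_rfl, fun i hi y hy hiy => ?_⟩
        rw [Finset.mem_sdiff] at hi hy ⊢
        exact ⟨hfin.2 i hi.1 y hy.1 hiy, hy.2⟩)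
      (by omega)
      (fun _ => by
        obtain ⟨w, hw⟩ := Finset.card_pos.1 (by omega : 0 < (T.below A' H \ I).card)
        obtain ⟨hw1, hwI⟩ := Finset.mem_sdiff.1 hw
        obtain ⟨hwH, a, ha, hwa⟩ := mem_below.1 hw1
        have hlt : ∀ i ∈ I, a < i := fun i hi =>
          (T.le_of_mem_desc hwa).trans_lt (hI.lt_of_notMem hi (hfin.1 hw1) hwI)
        have haH := mem_of_mem_desc hH hwH hwa
        exact ⟨a, Finset.mem_inter.2 ⟨hA'A ha, mem_before.2 ⟨haH, hlt⟩⟩,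
          Finset.mem_sdiff.2 ⟨self_mem_below ha haH, fun haI => lt_irrefl _ (hlt a haI)⟩⟩)
    exact ⟨φ, h3, h4, fun hx => (Finset.mem_inter.1 (h5 hx)).1⟩
  · obtain ⟨φ, h3, h4⟩ := h.exists_emb (S := S) hR (isLowerSet_before I hH)
      Finset.inter_subset_right (by omega) (by omega)
    exact ⟨φ, h3, h4, fun hx => absurd hx hxS⟩

/-- The induction step if the forest is cut at a single vertex `y`. -/
lemma Embeds.step_cut (h : T.Embeds F N) (hA : T.IsRoots l A) (hH : IsLowerSet (H : Set V))
    (hAH : A ⊆ H) {x₁ : W} (hx₁ : x₁ ∈ S) (hN : S.card + (T.below A H).card ≤ N + 1)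
    (hS : S.card ≤ (T.below A H).card) {A' : Finset V} (hA'A : A' ⊆ A)
    (hA' : ∀ b ∈ A', ∀ a ∈ A, b ≤ a → a ∈ A') (hA'S : (T.below A' H).card ≤ S.card)
    {v : V} (hv : v ∈ A) (hvA : ∀ a ∈ A, a ≤ v) {y : W} (hy : y ∈ S) {K : Finset W} (hK : K ⊆ S)
    (hyK : y ∉ K) (hxK : x₁ ∉ K) (hatt : F.IsAttached S K y)
    (hvK : (T.below {v} H).card ≤ K.card + 1) (hKA' : K.card + 1 < (T.below A' H).card) :
    ∃ φ : W → V, F.IsEmbOn (T.generated 2) S φ ∧ (S.image φ).IsFinal (T.below A H) ∧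
      (∀ y ∈ S, T.level (φ x₁) ≤ T.level (φ y)) := by
  have hcB : (insert y K).card = K.card + 1 := Finset.card_insert_of_notMem hyK
  have hBS : insert y K ⊆ S := Finset.insert_subset hy hK
  have hcS := Finset.card_sdiff_add_card_eq_card hBS
  -- The set `insert y K` is at least as large as the right-most branch, so its image contains the
  -- root `v`, and `y` is mapped to a root.
  obtain ⟨φ₁, h1, h2, h3⟩ := h.exists_emb_root (S := insert y K) (J := T.below {v} H) hA hH hAH
    (by omega) (by omega) y
    (hA.isFinal_below (Finset.singleton_subset_iff.2 hv) fun b hb a ha hba => by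
      rw [Finset.mem_singleton] at hb ⊢
      exact le_antisymm (hvA a ha) (hb ▸ hba))
    (by omega) (fun _ => ⟨v, hv, self_mem_below (Finset.mem_singleton_self v) (hAH hv)⟩)
  have h3 := h3 (Finset.mem_insert_self y K)
  have hcI := h1.card_image
  obtain ⟨φ₂, h4, h5, h6⟩ := h.exists_emb_rest (S := S \ insert y K) hA hH h2 (by omega) (by omega)
    x₁ hA'A hA' (fun _ => by omega)
  obtain ⟨φ, h7, h8, h9, h10⟩ := h1.exists_union h4 Finset.disjoint_sdiff
    (Finset.disjoint_left.2 fun w hw hw' => (Finset.mem_sdiff.1 (h5.1 hw')).2 hw)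
    (by
      intro u hu w hw huw
      obtain ⟨hwS, hwB⟩ := Finset.mem_sdiff.1 hw
      rcases Finset.mem_insert.1 hu with rfl | hu'
      · have hmem := h5.1 (Finset.mem_image_of_mem φ₂ hw)
        obtain ⟨hm1, hm2⟩ := Finset.mem_sdiff.1 hmem
        exact hA.adj_of_mem_below h3 hm1
          (h2.lt_of_notMem (Finset.mem_image_of_mem φ₁ hu) hm1 hm2)
      · have := hatt u hu' w hwS (fun hwK => hwB (Finset.mem_insert_of_mem hwK)) huw
        exact absurd (this ▸ Finset.mem_insert_self y K) hwB)
  rw [Finset.union_sdiff_of_subset hBS] at h7 h10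
  have hfin : (S.image φ).IsFinal (T.below A H) := h10 ▸ h2.union h5
  refine ⟨φ, h7, hfin, fun w hw => ?_⟩
  have hxA : φ x₁ ∈ A := by
    by_cases hxB : x₁ ∈ insert y K
    · have hxy := (Finset.mem_insert.1 hxB).resolve_right hxK
      rw [h8 x₁ hxB, hxy]
      exact h3
    · have hx := Finset.mem_sdiff.2 ⟨hx₁, hxB⟩
      rw [h9 x₁ hx]
      exact h6 hx
  rw [hA.level_eq _ hxA]
  exact hA.le_level (hfin.1 (Finset.mem_image_of_mem φ hw))

/-- Embedding several large pieces with a vertex of each mapped to a root. -/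
lemma Embeds.fill (h : T.Embeds F N) (hA : T.IsRoots l A) (hH : IsLowerSet (H : Set V))
    {b : ℕ} (hb : 1 ≤ b) (hAb : ∀ a ∈ A, (T.below {a} H).card ≤ b)
    {D : W → Finset W} (J : Finset W) (hJ : ∀ i ∈ J, i ∈ D i ∧ b ≤ (D i).card)
    (hD : ∀ i ∈ J, ∀ j ∈ J, i ≠ j → Disjoint (D i) (D j) ∧ ∀ u ∈ D i, ∀ v ∈ D j, ¬ F.Adj u v)
    (hN : (J.biUnion D).card + (T.below A H).card ≤ N)
    (hS : (J.biUnion D).card ≤ (T.below A H).card) :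
    ∃ φ : W → V, F.IsEmbOn (T.generated 2) (J.biUnion D) φ ∧
      ((J.biUnion D).image φ).IsFinal (T.below A H) ∧ ∀ i ∈ J, φ i ∈ A := by
  induction J using Finset.induction_on with
  | empty => exact ⟨fun _ => T.root, ⟨by simp, by simp⟩, by simpa using IsFinal.empty _, by simp⟩
  | insert i J hiJ ih =>
    have hd : Disjoint (J.biUnion D) (D i) := by
      rw [Finset.disjoint_biUnion_left]
      intro j hj
      refine (hD j (Finset.mem_insert_of_mem hj) i (Finset.mem_insert_self i J) ?_).1
      rintro rfl
      exact hiJ hj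
    rw [Finset.biUnion_insert, Finset.union_comm] at hN hS ⊢
    have hc := Finset.card_union_of_disjoint hd
    obtain ⟨hi, hib⟩ := hJ i (Finset.mem_insert_self i J)
    obtain ⟨φ₁, h1, h2, h3⟩ := ih (fun j hj => hJ j (Finset.mem_insert_of_mem hj))
      (fun j hj k hk => hD j (Finset.mem_insert_of_mem hj) k (Finset.mem_insert_of_mem hk))
      (by omega) (by omega)
    have hcI := h1.card_image
    generalize hI : (J.biUnion D).image φ₁ = I at h2 hcI
    have hcX := Finset.card_sdiff_add_card_eq_card h2.1
    have hne : (T.below A H \ I).Nonempty := by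
      rw [← Finset.card_pos]
      omega
    -- Let `a` be the root above the last unused vertex `w`. The unused vertices from `a` on all lie
    -- in its branch, so there are at most `b` of them. The next piece covers them, including `a`,
    -- and thus its vertex `i` is mapped to a root.
    obtain ⟨w, hw, hmax⟩ : ∃ w ∈ T.below A H \ I, ∀ x ∈ T.below A H \ I, x ≤ w :=
      ⟨_, Finset.max'_mem _ hne, fun x hx => Finset.le_max' _ x hx⟩
    obtain ⟨hw, hwI⟩ := Finset.mem_sdiff.1 hw
    obtain ⟨hwH, a, ha, hwa⟩ := mem_below.1 hw
    have hsub : insert w I ⊆ T.below (A.filter (a ≤ ·)) H := by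
      intro x hx
      rcases Finset.mem_insert.1 hx with rfl | hx
      · exact mem_below.2 ⟨hwH, a, by simp [ha], hwa⟩
      · obtain ⟨hxH, c, hc, hxc⟩ := mem_below.1 (h2.1 hx)
        refine mem_below.2 ⟨hxH, c, Finset.mem_filter.2 ⟨hc, ?_⟩, hxc⟩
        exact T.le_of_mem_desc_of_le ((hA.level_eq a ha).trans (hA.level_eq c hc).symm) hwa hxc
          (h2.lt_of_notMem hx hw hwI).le
    have hsub' : T.below (A.filter (a ≤ ·)) H ⊆ I ∪ T.below {a} H := by
      intro x hx
      obtain ⟨hxH, c, hc, hxc⟩ := mem_below.1 hx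
      obtain ⟨hcA, hac⟩ := Finset.mem_filter.1 hc
      rw [Finset.mem_union]
      by_cases hxI : x ∈ I
      · exact Or.inl hxI
      · right
        have hxw := hmax x (Finset.mem_sdiff.2 ⟨mem_below.2 ⟨hxH, c, hcA, hxc⟩, hxI⟩)
        have hca := T.le_of_mem_desc_of_le ((hA.level_eq c hcA).trans (hA.level_eq a ha).symm)
          hxc hwa hxw
        rw [le_antisymm hca hac] at hxc
        exact mem_below_singleton.2 ⟨hxH, hxc⟩
    have hc1 := Finset.card_le_card hsub
    rw [Finset.card_insert_of_notMem hwI] at hc1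
    have hc2 := (Finset.card_le_card hsub').trans (Finset.card_union_le _ _)
    have hc3 := hAb a ha
    obtain ⟨φ₂, h4, h5, h6⟩ := h.exists_emb_rest (S := D i) hA hH h2 (by omega) (by omega)
      i (A' := A.filter (a ≤ ·)) (Finset.filter_subset _ _)
      (fun b hb c hc hbc => Finset.mem_filter.2 ⟨hc, (Finset.mem_filter.1 hb).2.trans hbc⟩)
      (fun _ => by omega)
    obtain ⟨φ, h7, h8, h9, h10⟩ := h1.exists_union h4 hd
      (Finset.disjoint_left.2 fun w hw hw' => (Finset.mem_sdiff.1 (h5.1 hw')).2 (hI ▸ hw))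
      (by
        intro u hu w hw huw
        obtain ⟨j, hj, huj⟩ := Finset.mem_biUnion.1 hu
        refine absurd huw ((hD j (Finset.mem_insert_of_mem hj) i (Finset.mem_insert_self i J)
          ?_).2 u huj w hw)
        rintro rfl
        exact hiJ hj)
    refine ⟨φ, h7, ?_, fun j hj => ?_⟩
    · rw [h10, hI]
      exact h2.union h5
    · rcases Finset.mem_insert.1 hj with rfl | hj
      · rw [h9 j hi]
        exact h6 hi
      · rw [h8 j (Finset.mem_biUnion.2 ⟨j, hj, (hJ j (Finset.mem_insert_of_mem hj)).1⟩)]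
        exact h3 j hj

end DFSTree

/-! ### Three branches and a part attached at two vertices. -/

namespace DFSTree

open ParentTree Finset SimpleGraph

variable {V : Type u} [LinearOrder V] {W : Type v} [DecidableEq W]
  {T : DFSTree V} {F : SimpleGraph W} {N l : ℕ} {A H : Finset V} {S : Finset W}

/-- Embedding branches at `u`, a vertex `y` and a set `R` into the two right-most of the branches of
the tree, where `y` is mapped to the right-most root and all neighbours of `u` to children of the
two roots. -/
lemma Embeds.exists_emb_split (h : T.Embeds F N) (hA : T.IsRoots l A) (hH : IsLowerSet (H : Set V))
    (hAH : A ⊆ H) {p v : V} (hp : p ∈ A) (hv : v ∈ A) (hpv : p < v)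
    (hpA : ∀ w ∈ A, w < v → w ≤ p) (hvA : ∀ w ∈ A, w ≤ v)
    {P : ParentTree W} (hP : F.IsRooting S P) {b : ℕ} (hb : 1 ≤ b)
    (hbA : ∀ c ∈ T.childrenIn p H ∪ T.childrenIn v H, (T.below {c} H).card ≤ b)
    {u y r : W} {J R : Finset W} (hJ : J ⊆ P.childrenIn u S) (hR : R ⊆ S)
    (hyJ : y ∉ P.below J S) (hyR : y ∉ R) (hJR : Disjoint (P.below J S) R) (huR : u ∉ R)
    (hJb : ∀ i ∈ J, b ≤ (P.below {i} S).card)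
    (hge : (T.below {v} H).card ≤ (P.below J S).card + R.card + 1)
    (hle : (P.below J S).card + R.card + 2 ≤ (T.below {p} H).card + (T.below {v} H).card)
    (hrR : r ∈ R → (P.below J S).card + 2 ≤ (T.below {v} H).card)
    (hN : (P.below J S).card + R.card + (T.below A H).card ≤ N) :
    ∃ φ : W → V, F.IsEmbOn (T.generated 2) (insert y (P.below J S ∪ R)) φ ∧
      ((insert y (P.below J S ∪ R)).image φ).IsFinal (T.below A H) ∧ φ y = v ∧
      (∀ i ∈ J, T.level (φ i) = l + 1) ∧ (r ∈ R → T.level (φ r) = l + 1) ∧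
      (∀ w ∈ P.below J S ∪ R, φ w ∈ T.below (T.childrenIn p H ∪ T.childrenIn v H) H) := by
  have hlp : T.level p = l := hA.level_eq p hp
  have hlv : T.level v = l := hA.level_eq v hv
  have hcous : T.IsNearestLeftCousin p v := hA.isNearestLeftCousin hp hv hpv hpA
  have hRt : T.IsRoots (l + 1) (T.childrenIn p H ∪ T.childrenIn v H) :=
    hlv ▸ isRoots_childrenIn_union hH hcous
  have hRH : T.childrenIn p H ∪ T.childrenIn v H ⊆ H :=
    Finset.union_subset (childrenIn_subset _ _) (childrenIn_subset _ _)
  have hc := card_below_childrenIn_union (T := T) hH (hAH hp) (hAH hv) hpv.ne (hlp.trans hlv.symm)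
  have hX := below_pair (T := T) hH (hAH hp) (hAH hv)
  have hXA : T.below {p, v} H ⊆ T.below A H :=
    below_mono (by simp [Finset.insert_subset_iff, hp, hv]) subset_rfl
  have hsub0 : T.below (T.childrenIn p H ∪ T.childrenIn v H) H ⊆ T.below A H := by
    refine Finset.Subset.trans ?_ hXA
    rw [hX]
    exact (Finset.subset_insert _ _).trans (Finset.subset_insert _ _)
  have hc0 := Finset.card_le_card hsub0
  have hnev : ∀ w ∈ T.below (T.childrenIn p H ∪ T.childrenIn v H) H, w ≠ v := by
    rintro w hw rfl
    have := hRt.le_level hw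
    omega
  have hup : ∀ b ∈ T.childrenIn v H, ∀ a ∈ T.childrenIn p H ∪ T.childrenIn v H, b ≤ a →
      a ∈ T.childrenIn v H := by
    intro b hb a ha hba
    rcases Finset.mem_union.1 ha with ha | ha
    · exact absurd hba (not_le.2 (T.desc_lt_desc (hlp.trans hlv.symm) hpv
        (T.mem_desc_of_mem_children (mem_childrenIn.1 ha).2)
        (T.mem_desc_of_mem_children (mem_childrenIn.1 hb).2)))
    · exact ha
  have hcv := card_below (T := T) hH (hAH hv)
  have hJu : P.below J S = J.biUnion fun i => P.below {i} S := by
    ext w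
    simp only [mem_below, Finset.mem_biUnion, Finset.mem_singleton, exists_eq_left]
    tauto
  have hedge : ∀ i ∈ J, ∀ w ∈ P.below {i} S, ∀ w' ∈ S, w' ∉ P.below {i} S → F.Adj w w' →
      w = i ∧ w' = u := by
    intro i hi w hw w' hw' hn hadj
    obtain ⟨h1, h2⟩ := hP.edge_below hw hw' hn hadj
    exact ⟨h1, h2.trans (mem_childrenIn.1 (hJ hi)).2.2⟩
  have huJ : u ∉ P.below J S := IsRooting.notMem_below_of_subset hJ
  obtain ⟨φ₁, h1, h2, h3⟩ := h.fill (D := fun i => P.below {i} S) hRt hH hb hbA J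
    (fun i hi => ⟨self_mem_below (Finset.mem_singleton_self i) (childrenIn_subset _ _ (hJ hi)),
      hJb i hi⟩)
    (fun i hi j hj hij => by
      have hd : Disjoint (P.below {i} S) (P.below {j} S) := by
        refine disjoint_below (l := P.level u + 1) ?_ ?_ (by simpa using hij)
        · simpa using level_of_mem_childrenIn (hJ hi)
        · simpa using level_of_mem_childrenIn (hJ hj)
      refine ⟨hd, fun w hw w' hw' hadj => ?_⟩
      have := (hedge i hi w hw w' (below_subset _ _ hw') (Finset.disjoint_right.1 hd hw') hadj).2
      subst this
      exact huJ (below_mono (Finset.singleton_subset_iff.2 hj) subset_rfl hw'))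
    (by rw [← hJu]; omega) (by rw [← hJu]; omega)
  rw [← hJu] at h1 h2
  have hcI := h1.card_image
  -- By `hrR` the branches in `J` do not exhaust the proper descendants of `v`, while together with
  -- `R` they do by `hge`. Hence `r` can be required to land on a child of `p` or `v`.
  obtain ⟨φ₂, h4, h5, h6⟩ := h.exists_emb_rest (S := R) hRt hH h2 (by omega) (by omega) r
    (A' := T.childrenIn v H) Finset.subset_union_right hup
    (fun hr => by
      have := hrR hr
      omega)
  obtain ⟨φ₃, h7, h8, h9, h10⟩ := h1.exists_union h4 hJR
    (Finset.disjoint_left.2 fun w hw hw' => (Finset.mem_sdiff.1 (h5.1 hw')).2 hw)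
    (by
      intro w hw w' hw' hadj
      obtain ⟨i, hi, hwi⟩ := Finset.mem_biUnion.1 (hJu ▸ hw)
      have := (hedge i hi w hwi w' (hR hw') (fun h => Finset.disjoint_left.1 hJR
        (below_mono (Finset.singleton_subset_iff.2 hi) subset_rfl h) hw') hadj).2
      exact absurd (this ▸ hw') huR)
  have hfin₃ := h2.union h5
  rw [← h10] at hfin₃
  have hyU : y ∉ P.below J S ∪ R := fun hm => (Finset.mem_union.1 hm).elim hyJ hyR
  have herase : (insert y (P.below J S ∪ R)).erase y = P.below J S ∪ R :=
    Finset.erase_insert hyU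
  rw [← herase] at h7 hfin₃
  obtain ⟨φ, h11, h12, h13, h14⟩ := h7.exists_insert (a := v) (Finset.mem_insert_self y _)
    (fun hm => hnev v (hfin₃.1 hm) rfl)
    (by
      intro w hw _
      have hm := hfin₃.1 (Finset.mem_image_of_mem φ₃ hw)
      obtain ⟨hmH, ⟨hm1, hm2⟩ | ⟨hm1, hm2⟩⟩ := mem_below_childrenIn_union hm
      · exact hA.adj_of_lt p hp v hv hpv _ hm1
      · exact adj_desc hm2 hm1)
  have hcu := Finset.card_union_of_disjoint hJR
  have hcim := h7.card_image
  rw [herase] at h13 h14 hfin₃ hcim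
  refine ⟨φ, h11, ?_, h12, ?_, ?_, ?_⟩
  · rw [h14]
    exact hA.isFinal_insert hH hAH hp hv hpv hpA hvA hfin₃ (by omega)
  · intro i hi
    have hiJ : i ∈ P.below J S := self_mem_below hi (childrenIn_subset _ _ (hJ hi))
    rw [h13 i (Finset.mem_union_left _ hiJ), h8 i hiJ]
    exact hRt.level_eq _ (h3 i hi)
  · intro hr
    rw [h13 r (Finset.mem_union_right _ hr), h9 r hr]
    exact hRt.level_eq _ (h6 hr)
  · intro w hw
    rw [h13 w hw]
    exact hfin₃.1 (Finset.mem_image_of_mem φ₃ hw)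

/-- The induction step for three branches if the forest is split into branches at `u` and two
parts, one of which is joined to the rest only through a vertex `y`. -/
lemma Embeds.step_split (h : T.Embeds F N) {v₁ v₂ v₃ : V} (h₁₂ : v₁ < v₂) (h₂₃ : v₂ < v₃)
    (hA : T.IsRoots l {v₁, v₂, v₃}) (hH : IsLowerSet (H : Set V)) (hAH : {v₁, v₂, v₃} ⊆ H)
    {x₁ : W} (hx₁ : x₁ ∈ S) (hN : S.card + (T.below {v₁, v₂, v₃} H).card ≤ N + 1)
    (hS : S.card + 1 ≤ (T.below {v₁, v₂, v₃} H).card)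
    (hS' : (T.below {v₂} H).card + (T.below {v₃} H).card ≤ S.card)
    {P : ParentTree W} (hP : F.IsRooting S P) (hPx : P.root = x₁) {p : ℕ}
    (hp : p + 2 = (T.below {v₂} H).card)
    (hbA : ∀ c ∈ T.childrenIn v₂ H ∪ T.childrenIn v₃ H, (T.below {c} H).card ≤ p + 2)
    {u y r : W} {J R : Finset W} (hu : u ∈ S) (hy : y ∈ S) (hJ : J ⊆ P.childrenIn u S)
    (hR : R ⊆ S) (hyJ : y ∉ P.below J S) (hyR : y ∉ R) (hJR : Disjoint (P.below J S) R)
    (huR : u ∉ R) (huy : u ≠ y) (hxR : P.root ∉ R) (hxy : P.root ≠ y)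
    (hJb : ∀ i ∈ J, p + 2 ≤ (P.below {i} S).card)
    (hge : (T.below {v₃} H).card ≤ (P.below J S).card + R.card + 1)
    (hle : (P.below J S).card + R.card + 1 ≤ (T.below {v₃} H).card + p)
    (hatt : ∀ v ∈ R, ∀ v' ∈ S, v' ∉ R → F.Adj v v' → v' = y ∨ (v = r ∧ v' = u))
    (hrR : r ∈ R → (P.below J S).card + 2 ≤ (T.below {v₃} H).card) :
    ∃ φ : W → V, F.IsEmbOn (T.generated 2) S φ ∧
      (S.image φ).IsFinal (T.below {v₁, v₂, v₃} H) ∧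
      (∀ y ∈ S, T.level (φ x₁) ≤ T.level (φ y)) := by
  have hl₁ : T.level v₁ = l := hA.level_eq v₁ (by simp)
  have hl₂ : T.level v₂ = l := hA.level_eq v₂ (by simp)
  have hl₃ : T.level v₃ = l := hA.level_eq v₃ (by simp)
  have hH₁ : v₁ ∈ H := hAH (by simp)
  have hH₂ : v₂ ∈ H := hAH (by simp)
  have hH₃ : v₃ ∈ H := hAH (by simp)
  have hcous : T.IsNearestLeftCousin v₂ v₃ := hA.isNearestLeftCousin (by simp) (by simp) h₂₃ (by
    simp only [Finset.mem_insert, Finset.mem_singleton]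
    rintro w (rfl | rfl | rfl) hw
    · exact h₁₂.le
    · exact le_rfl
    · exact absurd hw (lt_irrefl _))
  have hyU : y ∉ P.below J S ∪ R := fun hm => (Finset.mem_union.1 hm).elim hyJ hyR
  have hcB := Finset.card_insert_of_notMem hyU
  rw [Finset.card_union_of_disjoint hJR] at hcB
  have hc1 := hA.card_below_erase (H := H) (a := v₁) (by simp)
  rw [Finset.erase_insert (by simp [h₁₂.ne, (h₁₂.trans h₂₃).ne])] at hc1
  have hc2 : (T.below {v₂, v₃} H).card = (T.below {v₂} H).card + (T.below {v₃} H).card := by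
    rw [Finset.insert_eq, card_below_union (l := l)]
    · simpa using hl₂
    · simpa using hl₃
    · simpa using h₂₃.ne
  obtain ⟨φ₁, h1, h2, h3, h4, h5, h6⟩ := h.exists_emb_split (p := v₂) (v := v₃) hA hH hAH (by simp)
    (by simp) h₂₃
    (by
      simp only [Finset.mem_insert, Finset.mem_singleton]
      rintro w (rfl | rfl | rfl) hw
      · exact h₁₂.le
      · exact le_rfl
      · exact absurd hw (lt_irrefl _))
    (by
      simp only [Finset.mem_insert, Finset.mem_singleton]
      rintro w (rfl | rfl | rfl)
      · exact (h₁₂.trans h₂₃).le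
      · exact h₂₃.le
      · exact le_rfl)
    hP (by omega) hbA hJ hR hyJ hyR hJR huR hJb hge (by omega) hrR (by omega)
  have hcI := h1.card_image
  have hBS : insert y (P.below J S ∪ R) ⊆ S :=
    Finset.insert_subset hy (Finset.union_subset (below_subset _ _) hR)
  have hcS := Finset.card_sdiff_add_card_eq_card hBS
  generalize hB : insert y (P.below J S ∪ R) = B at *
  generalize hI : B.image φ₁ = I at h2 hcI
  have hX := below_before hH h2
  have hcX := Finset.card_sdiff_add_card_eq_card h2.1
  have hmemI : ∀ i ∈ I, i = v₃ ∨ i ∈ T.below (T.childrenIn v₂ H ∪ T.childrenIn v₃ H) H := by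
    intro i hi
    rw [← hI] at hi
    obtain ⟨w, hw, rfl⟩ := Finset.mem_image.1 hi
    rw [← hB] at hw
    rcases Finset.mem_insert.1 hw with rfl | hw
    · exact Or.inl h3
    · exact Or.inr (h6 w hw)
  have hlt₂ : ∀ i ∈ I, v₂ < i := by
    intro i hi
    rcases hmemI i hi with rfl | hi
    · exact h₂₃
    · obtain ⟨-, ⟨hm1, hm2⟩ | ⟨hm1, hm2⟩⟩ := mem_below_childrenIn_union hi
      · exact T.lt_of_mem_desc hm1 hm2
      · exact T.desc_lt_desc (hl₂.trans hl₃.symm) h₂₃ (T.mem_desc_self v₂) hm1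
  have hyB : y ∈ B := hB ▸ Finset.mem_insert_self _ _
  have hv₃I : v₃ ∈ I := by
    rw [← hI, ← h3]
    exact Finset.mem_image_of_mem φ₁ hyB
  have hlow := isLowerSet_before I hH
  have hb₂ : v₂ ∈ before I H := mem_before.2 ⟨hH₂, hlt₂⟩
  have hb₁ : v₁ ∈ before I H := hlow h₁₂.le hb₂
  have hA' : ({v₁, v₂, v₃} : Finset V) ∩ before I H = {v₁, v₂} := by
    ext w
    simp only [Finset.mem_inter, Finset.mem_insert, Finset.mem_singleton]
    constructor
    · rintro ⟨rfl | rfl | rfl, hw⟩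
      · exact Or.inl rfl
      · exact Or.inr rfl
      · exact absurd ((mem_before.1 hw).2 w hv₃I) (lt_irrefl _)
    · rintro (rfl | rfl)
      · exact ⟨Or.inl rfl, hb₁⟩
      · exact ⟨Or.inr (Or.inl rfl), hb₂⟩
  have hRt := hA.inter_lower hlow
  rw [hA'] at hX hRt
  rw [← hX] at hcX
  have hc3 := hRt.card_below_erase (H := before I H) (a := v₁) (by simp)
  rw [Finset.erase_insert (by simpa using h₁₂.ne)] at hc3
  -- Everything used so far lies after `v₂`, so the branch at `v₁` is still complete.
  have hc4 : T.below {v₁} (before I H) = T.below {v₁} H := by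
    ext w
    rw [mem_below_singleton, mem_below_singleton, mem_before]
    constructor
    · rintro ⟨⟨hw, -⟩, hd⟩
      exact ⟨hw, hd⟩
    · rintro ⟨hw, hd⟩
      exact ⟨⟨hw, fun i hi => (T.desc_lt_desc (hl₁.trans hl₂.symm) h₁₂ hd
        (T.mem_desc_self v₂)).trans (hlt₂ i hi)⟩, hd⟩
  rw [hc4] at hc3
  have hxB : x₁ ∉ B := by
    rw [← hB, ← hPx, Finset.mem_insert, Finset.mem_union]
    rintro (hm | hm | hm)
    · exact hxy hm
    · exact IsRooting.root_notMem_below hJ hm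
    · exact hxR hm
  have huB : u ∉ B := by
    rw [← hB, Finset.mem_insert, Finset.mem_union]
    rintro (hm | hm | hm)
    · exact huy hm
    · exact IsRooting.notMem_below_of_subset hJ hm
    · exact huR hm
  have hxSB := Finset.mem_sdiff.2 ⟨hx₁, hxB⟩
  have huSB := Finset.mem_sdiff.2 ⟨hu, huB⟩
  obtain ⟨φ₂, h7, h8, h9, h10⟩ := h l {v₁, v₂} (before I H) (S \ B) x₁ u hRt hlow
    (by simp [Finset.insert_subset_iff, hb₁, hb₂]) hxSB huSB (by omega) (by omega)
  -- At most `p` vertices more than the branch of `v₃` have been used, all in the branches of `v₂`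
  -- and `v₃`. As the branch of `v₂` has `p + 2` vertices, at least two are left there. By `hS'` the
  -- rest of `S` fills them, and by `hS` it leaves a vertex free. This is what brings `u` to level
  -- at most `l + 1`.
  have h10 := h10 v₁ v₂ rfl h₁₂ (by omega) (by omega) (by omega)
  have hlx : T.level (φ₂ x₁) ≤ l := by
    have hJ' : (T.below {v₂} (before I H)).IsFinal (T.below {v₁, v₂} (before I H)) := by
      refine hRt.isFinal_below (by simp) ?_
      simp only [Finset.mem_singleton, Finset.mem_insert]
      rintro b rfl a (rfl | rfl) hba
      · exact absurd hba (not_le.2 h₁₂)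
      · rfl
    have hsub := h8.subset_of_card_le hJ' (by rw [h7.card_image]; omega)
    obtain ⟨w, hw, hwv⟩ := Finset.mem_image.1
      (hsub (self_mem_below (Finset.mem_singleton_self v₂) hb₂))
    rw [← hl₂, ← hwv]
    exact h9 w hw
  rw [hX] at h8
  obtain ⟨φ, h11, h12, h13, h14⟩ := h1.exists_union h7 Finset.disjoint_sdiff
    (Finset.disjoint_left.2 fun w hw hw' => (Finset.mem_sdiff.1 (h8.1 hw')).2 (hI ▸ hw))
    (by
      intro e he f hf hef
      have hfm := h8.1 (Finset.mem_image_of_mem φ₂ hf)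
      obtain ⟨hfS, hfB⟩ := Finset.mem_sdiff.1 hf
      obtain ⟨hfm1, hfm2⟩ := Finset.mem_sdiff.1 hfm
      have heI : φ₁ e ∈ I := hI ▸ Finset.mem_image_of_mem φ₁ he
      -- Edges to `u` are realised because both ends are on level at most `l + 1`. All other edges
      -- leaving `B` come from `y`, which sits on `v₃`, to the right of the remainder.
      have key : T.level (φ₁ e) = l + 1 → f = u →
          (T.generated 2).Adj (φ₁ e) (φ₂ f) := by
        rintro hle rfl
        refine hA.adj_of_level_le (h2.1 heI) hfm1 hle.le h10 ?_
        intro heq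
        exact hfm2 (heq ▸ heI)
      have he' := hB ▸ he
      rcases Finset.mem_insert.1 he' with rfl | he'
      · rw [h3]
        exact hA.adj_of_mem_below (by simp) hfm1 (h2.lt_of_notMem hv₃I hfm1 hfm2)
      · rcases Finset.mem_union.1 he' with heJ | heR
        · obtain ⟨heS, i, hi, hei⟩ := mem_below.1 heJ
          obtain ⟨h15, h16⟩ := hP.edge_below (mem_below_singleton.2 ⟨heS, hei⟩) hfS
            (fun hm => hfB (by
              rw [← hB]
              exact Finset.mem_insert_of_mem (Finset.mem_union_left _
                (below_mono (Finset.singleton_subset_iff.2 hi) subset_rfl hm)))) hef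
          exact key (h15 ▸ h4 i hi) (h16.trans (mem_childrenIn.1 (hJ hi)).2.2)
        · rcases hatt e heR f hfS (fun hm => hfB (by
            rw [← hB]
            exact Finset.mem_insert_of_mem (Finset.mem_union_right _ hm))) hef with rfl | ⟨rfl, hfu⟩
          · exact absurd hyB hfB
          · exact key (h5 heR) hfu)
  rw [Finset.union_sdiff_of_subset hBS] at h11 h14
  have hfin : (S.image φ).IsFinal (T.below {v₁, v₂, v₃} H) := by
    rw [h14, hI]
    exact h2.union h8
  refine ⟨φ, h11, hfin, fun w hw => ?_⟩
  rw [h13 x₁ hxSB]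
  exact hlx.trans (hA.le_level (hfin.1 (Finset.mem_image_of_mem φ hw)))

end DFSTree

/-! ### The conditions on the tree after truncation, and the induction. -/

namespace DFSTree

open ParentTree Finset SimpleGraph

variable {V : Type u} [LinearOrder V] {W : Type v} [DecidableEq W]
  {T : DFSTree V} {F : SimpleGraph W} {N l : ℕ} {A H : Finset V} {S : Finset W}

/-- Truncation to a lower set leaves every branch to the left of a present vertex on its level
complete. So lower bounds on the sizes of left cousins survive, while the branches they are compared
with can only shrink. -/
lemma card_below_eq_nu_of_lt {H : Finset V} (hH : IsLowerSet (H : Set V)) {a b : V} (hb : b ∈ H)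
    (hl : T.level a = T.level b) (hab : a < b) : (T.below {a} H).card = T.nu a :=
  card_below_eq_nu (desc_subset_of_lt hH hb hl hab)

lemma IsKsTree.card_below_le_add [Finite V] (hT : T.IsKsTree 4 1)
    (hH : IsLowerSet (H : Set V)) {u p q : V} (hu : u ∈ H)
    (hp : T.IsNearestLeftCousin p u) (hq : T.IsNearestLeftCousin q p) :
    (T.below {u} H).card ≤ (T.below {q} H).card + (T.below {p} H).card := by
  rw [card_below_eq_nu_of_lt hH hu hp.1.1 hp.1.2,
    card_below_eq_nu_of_lt hH hu (hq.1.1.trans hp.1.1) (hq.1.2.trans hp.1.2)]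
  exact (card_below_le_nu u H).trans (hT.nu_le_add u p q hp hq)

lemma IsKsTree.card_below_le_mul [Finite V] (hT : T.IsKsTree 4 1)
    (hH : IsLowerSet (H : Set V)) {u p : V} (hu : u ∈ H)
    (hp : T.IsNearestLeftCousin p u) : (T.below {u} H).card ≤ 4 * (T.below {p} H).card := by
  rw [card_below_eq_nu_of_lt hH hu hp.1.1 hp.1.2]
  refine (card_below_le_nu u H).trans ?_
  have h := hT.nu_le_mul u p hp
  rw [Nat.cast_ofNat, div_le_iff₀ (by norm_num)] at h
  have : (T.nu u : ℝ) ≤ ((4 * T.nu p : ℕ) : ℝ) := by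
    push_cast
    linarith
  exact_mod_cast this

lemma IsKsTree.card_below_le_of_level [Finite V] (hT : T.IsKsTree 4 1)
    (hH : IsLowerSet (H : Set V)) {u p c : V} (hu : u ∈ H)
    (hp : T.IsNearestLeftCousin p u) (hc : T.level p + 1 ≤ T.level c) :
    (T.below {c} H).card ≤ (T.below {p} H).card := by
  rw [card_below_eq_nu_of_lt hH hu hp.1.1 hp.1.2]
  exact (card_below_le_nu c H).trans (hT.nu_le_of_level p ⟨u, hp.1.1.symm, hp.1.2⟩ c hc)

lemma IsKsTree.two_le_card_below [Finite V] (hT : T.IsKsTree 4 1)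
    (hH : IsLowerSet (H : Set V)) {u p : V} (hu : u ∈ H)
    (hp : T.IsNearestLeftCousin p u) (h : 2 ≤ (T.below {u} H).card) :
    2 ≤ (T.below {p} H).card := by
  have hcu := card_below (T := T) hH hu
  obtain ⟨w, hw⟩ := Finset.card_pos.1 (by omega : 0 < (T.below (T.childrenIn u H) H).card)
  obtain ⟨-, c, hc, -⟩ := mem_below.1 hw
  obtain ⟨d, hd⟩ := hT.children_nonempty u p hp ⟨c, (mem_childrenIn.1 hc).2⟩
  have hsub := desc_subset_of_lt hH hu hp.1.1 hp.1.2
  have hdH : d ∈ H := hsub (T.mem_desc_of_mem_children hd)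
  have hpH : p ∈ H := hsub (T.mem_desc_self p)
  have hcp := card_below (T := T) hH hpH
  have : 0 < (T.below (T.childrenIn p H) H).card :=
    Finset.card_pos.2 ⟨d, self_mem_below (mem_childrenIn.2 ⟨hdH, hd⟩) hdH⟩
  omega

lemma IsRoots.add_add_le_card_below (hA : T.IsRoots l A) {B : Finset V} (hBA : B ⊆ A) {a b c : V}
    (ha : a ∈ B) (hb : b ∈ B) (hc : c ∈ B) (hab : a < b) (hbc : b < c) :
    (T.below {a} H).card + (T.below {b} H).card + (T.below {c} H).card ≤ (T.below B H).card := by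
  rw [ParentTree.card_below_eq_sum (A := B) (l := l) fun a ha => hA.level_eq a (hBA ha)]
  have hsub : ({a, b, c} : Finset V) ⊆ B := by simp [Finset.insert_subset_iff, ha, hb, hc]
  refine le_trans (le_of_eq ?_) (Finset.sum_le_sum_of_subset hsub)
  rw [Finset.sum_insert (by simp [hab.ne, (hab.trans hbc).ne]), Finset.sum_insert (by simp [hbc.ne]),
    Finset.sum_singleton, add_assoc]

/-- The induction step for at least three branches the left-most of which is needed. -/
lemma Embeds.step_three [Finite V] (hT : T.IsKsTree 4 1) (h : T.Embeds F N) (hF : F.IsAcyclic)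
    (hA : T.IsRoots l A) (hH : IsLowerSet (H : Set V)) (hAH : A ⊆ H) {x₁ : W} (hx₁ : x₁ ∈ S)
    (hN : S.card + (T.below A H).card ≤ N + 1) (hS : S.card ≤ (T.below A H).card)
    {v₁ v₂ v₃ q : V} (hv₁ : v₁ ∈ A) (hv₂ : v₂ ∈ A) (hv₃ : v₃ ∈ A) (hq : q ∈ A) (hq₂ : q < v₂)
    (h₂₃ : v₂ < v₃) (hmin : ∀ a ∈ A, v₁ ≤ a) (hmax : ∀ a ∈ A, a ≤ v₃)
    (hmax₂ : ∀ a ∈ A, a < v₃ → a ≤ v₂) (hmaxq : ∀ a ∈ A, a < v₂ → a ≤ q)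
    (hlt : (T.below (A.erase v₁) H).card < S.card) :
    ∃ φ : W → V, F.IsEmbOn (T.generated 2) S φ ∧ (S.image φ).IsFinal (T.below A H) ∧
      (∀ y ∈ S, T.level (φ x₁) ≤ T.level (φ y)) := by
  have hc₂ := hA.isNearestLeftCousin hv₂ hv₃ h₂₃ hmax₂
  have hcq := hA.isNearestLeftCousin hq hv₂ hq₂ hmaxq
  have hH₃ := hAH hv₃
  have hH₂ := hAH hv₂
  have hadd := hT.card_below_le_add hH hH₃ hc₂ hcq
  have hpos : 1 ≤ (T.below {v₃} H).card :=
    Finset.card_pos.2 ⟨v₃, self_mem_below (Finset.mem_singleton_self v₃) hH₃⟩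
  have hqv₁ := hmin q hq
  have hup : ∀ b ∈ A.erase v₁, ∀ a ∈ A, b ≤ a → a ∈ A.erase v₁ := by
    intro b hb a ha hba
    refine Finset.mem_erase.2 ⟨?_, ha⟩
    rintro rfl
    obtain ⟨hb1, hb2⟩ := Finset.mem_erase.1 hb
    exact hb1 (le_antisymm hba (hmin b hb2))
  obtain ⟨P, hPx, hP⟩ := hF.exists_isRooting hx₁
  -- Cutting with `k = a - 1`, where `a` is the size of the right-most branch, gives together with
  -- `y` at least `a` and fewer than `2 * a` vertices. Some of the branches at `A'` is left for the
  -- rest, so `x₁` gets a root as well.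
  have step : ∀ A' ⊆ A, (∀ b ∈ A', ∀ a ∈ A, b ≤ a → a ∈ A') → (T.below A' H).card ≤ S.card →
      2 * (T.below {v₃} H).card ≤ (T.below A' H).card →
      ∃ φ : W → V, F.IsEmbOn (T.generated 2) S φ ∧ (S.image φ).IsFinal (T.below A H) ∧
        (∀ y ∈ S, T.level (φ x₁) ≤ T.level (φ y)) := by
    intro A' hA'A hA' hA'S h2
    obtain ⟨y, hy, K, hK, hK1, hK2⟩ := hP.exists_cut (k := (T.below {v₃} H).card - 1) hP.root_mem
      (by rw [IsRooting.below_root]; omega)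
    exact h.step_cut hA hH hAH hx₁ hN hS hA'A hA' hA'S hv₃ hmax (below_subset _ _ hy)
      (below_subset _ _) (IsRooting.notMem_below_of_subset hK)
      (hPx ▸ IsRooting.root_notMem_below hK) (hP.isAttached_below hK) (by omega) (by omega)
  by_cases hfull : (T.below A H).card ≤ S.card
  · have := hA.add_add_le_card_below (H := H) subset_rfl hq hv₂ hv₃ hq₂ h₂₃
    exact step A subset_rfl (fun _ _ a ha _ => ha) hfull (by omega)
  by_cases h2 : 2 * (T.below {v₃} H).card ≤ (T.below (A.erase v₁) H).card
  · exact step _ (Finset.erase_subset _ _) hup hlt.le h2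
  -- A third branch apart from that of `v₁` would make the total at least `2 * a`, by the first
  -- condition on the tree.
  have hq₁ : q = v₁ := by
    by_contra hne
    have := hA.add_add_le_card_below (H := H) (B := A.erase v₁) (Finset.erase_subset _ _)
      (Finset.mem_erase.2 ⟨hne, hq⟩)
      (Finset.mem_erase.2 ⟨(hqv₁.trans_lt hq₂).ne', hv₂⟩)
      (Finset.mem_erase.2 ⟨(hqv₁.trans_lt (hq₂.trans h₂₃)).ne', hv₃⟩) hq₂ h₂₃
    omega
  subst hq₁
  have hAeq : A = {q, v₂, v₃} := by
    ext w
    simp only [Finset.mem_insert, Finset.mem_singleton]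
    constructor
    · intro hw
      rcases (hmax w hw).eq_or_lt with h3 | h3
      · exact Or.inr (Or.inr h3)
      rcases (hmax₂ w hw h3).eq_or_lt with h3 | h3
      · exact Or.inr (Or.inl h3)
      exact Or.inl (le_antisymm (hmaxq w hw h3) (hmin w hw))
    · rintro (rfl | rfl | rfl) <;> assumption
  have hcA : (T.below (A.erase q) H).card = (T.below {v₂} H).card + (T.below {v₃} H).card := by
    rw [hAeq, Finset.erase_insert (by simp [hq₂.ne, (hq₂.trans h₂₃).ne]), Finset.insert_eq,
      card_below_union (l := l)]
    · simpa using hA.level_eq v₂ hv₂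
    · simpa using hA.level_eq v₃ hv₃
    · simpa using h₂₃.ne
  have hpos₂ : 1 ≤ (T.below {v₂} H).card :=
    Finset.card_pos.2 ⟨v₂, self_mem_below (Finset.mem_singleton_self v₂) hH₂⟩
  -- The right-most branch is larger than that of `v₂`, so `v₃` has a child in `H`, and then so has
  -- `v₂`.
  have htwo := hT.two_le_card_below hH hH₃ hc₂ (by omega)
  obtain ⟨p, hp⟩ := Nat.exists_eq_add_of_le htwo
  have hmul := hT.card_below_le_mul hH hH₃ hc₂
  -- The two right-most branches have `a + p + 2` vertices. A part of at least `a` and at most `a +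
  -- p + 1` vertices, attached at `y`, leaves one of them free, and cutting at one vertex is enough.
  -- Otherwise the hypothesis of `exists_split` holds.
  by_cases hcut : ∃ y ∈ S, ∃ K ⊆ S, y ∉ K ∧ P.root ∉ K ∧ F.IsAttached S K y ∧
      (T.below {v₃} H).card ≤ K.card + 1 ∧ K.card + 1 ≤ (T.below {v₃} H).card + p + 1
  · obtain ⟨y, hy, K, hK, hyK, hxK, hatt, hK1, hK2⟩ := hcut
    exact h.step_cut hA hH hAH hx₁ hN hS (Finset.erase_subset _ _) hup hlt.le hv₃ hmax hy hK hyK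
      (hPx ▸ hxK) hatt hK1 (by omega)
  · obtain ⟨u, hu, y, hy, J, hJ, R, hR, r, h3, h4, h5, h6, h7, h8, h9, h10, h11, h12, h13, h14⟩ :=
      hP.exists_split (a := (T.below {v₃} H).card) (p := p) hpos (by omega) (by omega)
        (fun y hy K hK hyK hxK hatt hK1 => by
          by_contra hK2
          exact hcut ⟨y, hy, K, hK, hyK, hxK, hatt, hK1, not_lt.1 hK2⟩)
    subst hAeq
    refine h.step_split hq₂ h₂₃ hA hH hAH hx₁ hN (by omega) (by omega) hP hPx (p := p) (by omega)
      (fun c hc => ?_) hu hy hJ hR h3 h4 h5 h6 h7 h8 h9 h10 h11 (by omega) h13 h14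
    have hlc : T.level c = T.level v₂ + 1 := by
      rcases Finset.mem_union.1 hc with hc | hc
      · exact level_of_mem_childrenIn hc
      · rw [level_of_mem_childrenIn hc, hc₂.1.1]
    -- By the third condition on the tree, no branch one level down is larger than that of `v₂`, so
    -- each piece of `p + 2` vertices reaches a root there.
    have := hT.card_below_le_of_level hH hH₃ hc₂ hlc.ge
    omega

theorem embeds [Finite V] (hT : T.IsKsTree 4 1) (hF : F.IsAcyclic) (N : ℕ) : T.Embeds F N := by
  induction N with
  | zero =>
    intro l A H S x₁ x₂ _ _ _ hx₁ _ hN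
    have := Finset.card_pos.2 ⟨x₁, hx₁⟩
    omega
  | succ N ih =>
    intro l A H S x₁ x₂ hA hH hAH hx₁ hx₂ hN hS
    have hSpos := Finset.card_pos.2 ⟨x₁, hx₁⟩
    have hne : A.Nonempty := by
      rw [Finset.nonempty_iff_ne_empty]
      rintro rfl
      rw [below_empty, Finset.card_empty] at hS
      omega
    obtain ⟨v₁, hv₁, hmin⟩ : ∃ v ∈ A, ∀ a ∈ A, v ≤ a :=
      ⟨A.min' hne, A.min'_mem hne, fun a ha => A.min'_le a ha⟩
    obtain ⟨v₃, hv₃, hmax⟩ : ∃ v ∈ A, ∀ a ∈ A, a ≤ v :=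
      ⟨A.max' hne, A.max'_mem hne, fun a ha => A.le_max' a ha⟩
    by_cases h₁₃ : v₁ = v₃
    · have hAeq : A = {v₁} := by
        ext w
        rw [Finset.mem_singleton]
        exact ⟨fun hw => le_antisymm (h₁₃ ▸ hmax w hw) (hmin w hw), fun hw => hw ▸ hv₁⟩
      subst hAeq
      obtain ⟨φ, h1, h2, h3⟩ := ih.step_one hA hH (hAH hv₁) hx₁ hN hS
      refine ⟨φ, h1, h2, h3, fun a b hab hlt => ?_⟩
      have := congrArg Finset.card hab
      rw [Finset.card_pair hlt.ne, Finset.card_singleton] at this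
      omega
    have h₁₃' : v₁ < v₃ := lt_of_le_of_ne (hmin v₃ hv₃) h₁₃
    by_cases htwo : A = {v₁, v₃} ∧ (T.below {v₃} H).card ≤ S.card
    · obtain ⟨hAeq, hge⟩ := htwo
      subst hAeq
      obtain ⟨φ, h1, h2, h3, h4⟩ := ih.step_two hF h₁₃' hA hH (hAH hv₁) (hAH hv₃) hx₁ hx₂ hN hS hge
      refine ⟨φ, h1, h2, h3, fun a b hab hlt hb _ => ?_⟩
      have hb' : b = v₃ := by
        have hbm : b ∈ ({v₁, v₃} : Finset V) := hab ▸ (by simp)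
        have ham : a ∈ ({v₁, v₃} : Finset V) := hab ▸ (by simp)
        simp only [Finset.mem_insert, Finset.mem_singleton] at hbm ham
        rcases hbm with rfl | rfl
        · rcases ham with rfl | rfl
          · exact absurd hlt (lt_irrefl _)
          · exact absurd hlt (not_lt.2 h₁₃'.le)
        · rfl
      exact h4 (hb' ▸ hb)
    -- The clause on `x₂` concerns only two branches of which the right one is filled, and this case
    -- is settled.
    have hvac : ∀ a b : V, A = {a, b} → a < b → (T.below {b} H).card ≤ S.card → False := by
      rintro a b rfl hab hb
      have ha : v₁ = a := le_antisymm (hmin a (by simp)) (by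
        rcases Finset.mem_insert.1 hv₁ with rfl | h
        · exact le_rfl
        · rw [Finset.mem_singleton.1 h]
          exact hab.le)
      have hb' : v₃ = b := le_antisymm (by
        rcases Finset.mem_insert.1 hv₃ with rfl | h
        · exact hab.le
        · rw [Finset.mem_singleton.1 h]) (hmax b (by simp))
      subst ha hb'
      exact htwo ⟨rfl, hb⟩
    suffices hs : ∃ φ : W → V, F.IsEmbOn (T.generated 2) S φ ∧
        (S.image φ).IsFinal (T.below A H) ∧ (∀ y ∈ S, T.level (φ x₁) ≤ T.level (φ y)) by
      obtain ⟨φ, h1, h2, h3⟩ := hs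
      exact ⟨φ, h1, h2, h3, fun a b hab hlt _ hb _ => (hvac a b hab hlt hb).elim⟩
    have herase := hA.card_below_erase (H := H) hv₁
    have hup : ∀ b ∈ A.erase v₁, ∀ a ∈ A, b ≤ a → a ∈ A.erase v₁ := by
      intro b hb a ha hba
      refine Finset.mem_erase.2 ⟨?_, ha⟩
      rintro rfl
      obtain ⟨hb1, hb2⟩ := Finset.mem_erase.1 hb
      exact hb1 (le_antisymm hba (hmin b hb2))
    -- A left-most branch that is not needed is dropped.
    by_cases hle : S.card ≤ (T.below (A.erase v₁) H).card
    · have hpos : 1 ≤ (T.below {v₁} H).card :=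
        Finset.card_pos.2 ⟨v₁, self_mem_below (Finset.mem_singleton_self v₁) (hAH hv₁)⟩
      obtain ⟨φ, h1, h2, h3, -⟩ := ih l (A.erase v₁) H S x₁ x₂
        (hA.subset (Finset.erase_subset _ _) fun a ha _ _ w hw haw _ => hup a ha w hw haw) hH
        ((Finset.erase_subset _ _).trans hAH) hx₁ hx₂ (by omega) hle
      exact ⟨φ, h1, h2.trans (hA.isFinal_below (Finset.erase_subset _ _) hup), h3⟩
    · have hne₂ : (A.filter (· < v₃)).Nonempty := ⟨v₁, by simp [hv₁, h₁₃']⟩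
      obtain ⟨v₂, hv₂, hmax₂⟩ : ∃ v ∈ A.filter (· < v₃), ∀ a ∈ A.filter (· < v₃), a ≤ v :=
        ⟨_, Finset.max'_mem _ hne₂, fun a ha => Finset.le_max' _ a ha⟩
      obtain ⟨hv₂A, h₂₃⟩ := Finset.mem_filter.1 hv₂
      have h₁₂ : v₁ < v₂ := by
        refine lt_of_le_of_ne (hmin v₂ hv₂A) ?_
        rintro rfl
        have hAeq : A = {v₁, v₃} := by
          ext w
          simp only [Finset.mem_insert, Finset.mem_singleton]
          constructor
          · intro hw
            rcases (hmax w hw).eq_or_lt with h | h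
            · exact Or.inr h
            · exact Or.inl (le_antisymm (hmax₂ w (Finset.mem_filter.2 ⟨hw, h⟩)) (hmin w hw))
          · rintro (rfl | rfl) <;> assumption
        refine htwo ⟨hAeq, ?_⟩
        have hsub : T.below {v₃} H ⊆ T.below (A.erase v₁) H :=
          below_mono (by simpa using ⟨h₁₃'.ne', hv₃⟩) subset_rfl
        have := Finset.card_le_card hsub
        omega
      have hneq : (A.filter (· < v₂)).Nonempty := ⟨v₁, by simp [hv₁, h₁₂]⟩
      obtain ⟨q, hq, hmaxq⟩ : ∃ v ∈ A.filter (· < v₂), ∀ a ∈ A.filter (· < v₂), a ≤ v :=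
        ⟨_, Finset.max'_mem _ hneq, fun a ha => Finset.le_max' _ a ha⟩
      obtain ⟨hqA, hq₂⟩ := Finset.mem_filter.1 hq
      exact ih.step_three hT hF hA hH hAH hx₁ hN hS hv₁ hv₂A hv₃ hqA hq₂ h₂₃ hmin hmax
        (fun a ha hlt => hmax₂ a (Finset.mem_filter.2 ⟨ha, hlt⟩))
        (fun a ha hlt => hmaxq a (Finset.mem_filter.2 ⟨ha, hlt⟩)) (not_le.1 hle)

end DFSTree

/-! ### The three conclusions. -/

namespace DFSTree

open ParentTree Finset SimpleGraph

variable {V : Type u} [Fintype V] [LinearOrder V] {T : DFSTree V}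

lemma below_root_eq {H : Finset V} : T.below {T.root} H = H := by
  ext w
  rw [mem_below_singleton]
  exact ⟨fun h => h.1, fun h => ⟨h, T.mem_desc_root w⟩⟩

lemma exists_copy (hT : T.IsKsTree 4 1) {W : Type v} [Fintype W] {F : SimpleGraph W}
    (hF : F.IsAcyclic) (hc : Fintype.card W ≤ Fintype.card V) (x₁ x₂ : W) :
    ∃ φ : F.Copy (T.generated 2),
      T.IsAdmissible (Set.range φ)ᶜ ∧
      (∀ y : W, T.level (φ x₁) ≤ T.level (φ y)) ∧
      ((T.children T.root).ncard = 2 →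
        ∀ v₂ : V, IsGreatest (T.children T.root) v₂ →
          2 ≤ T.nu v₂ → T.nu v₂ ≤ Fintype.card W → Fintype.card W + 2 ≤ Fintype.card V →
          T.level (φ x₂) ≤ 2) := by
  classical
  have hlow : IsLowerSet ((Finset.univ : Finset V) : Set V) := by
    rw [Finset.coe_univ]
    exact isLowerSet_univ
  have hroot : (T.below {T.root} Finset.univ).card = Fintype.card V := by
    rw [below_root_eq, Finset.card_univ]
  have key : ∀ φ : W → V, F.IsEmbOn (T.generated 2) Finset.univ φ →
      ∃ ψ : F.Copy (T.generated 2), ∀ w, ψ w = φ w := fun φ h =>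
    ⟨⟨⟨φ, fun {a b} hab => h.2 a (Finset.mem_univ a) b (Finset.mem_univ b) hab⟩,
      fun a b hab => h.1 (by simp) (by simp) hab⟩, fun _ => rfl⟩
  -- The root of the tree is used only if all vertices are needed. Otherwise the induction starts
  -- from its children with `l = 1`, so the bound `l + 1` for `x₂` becomes 2, and two spare vertices
  -- in the tree mean one spare vertex below the root.
  rcases hc.eq_or_lt with heq | hlt
  · obtain ⟨φ, h1, h2, h3, -⟩ := embeds hT hF _ 0 {T.root} Finset.univ Finset.univ x₁ x₂
      isRoots_root hlow (Finset.subset_univ _) (Finset.mem_univ _) (Finset.mem_univ _) le_rfl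
      (by rw [hroot, Finset.card_univ]; exact hc)
    obtain ⟨ψ, hψ⟩ := key φ h1
    refine ⟨ψ, ?_, fun y => ?_, fun _ _ _ _ _ _ => by omega⟩
    · intro a b hba ha hb
      obtain ⟨w, rfl⟩ := hb
      have hmem := h2.2 (φ w) (Finset.mem_image_of_mem φ (Finset.mem_univ w)) a
        (by rw [below_root_eq]; exact Finset.mem_univ a) (hψ w ▸ hba)
      obtain ⟨w', -, hw'⟩ := Finset.mem_image.1 hmem
      exact ha ⟨w', (hψ w').trans hw'⟩
    · rw [hψ, hψ]
      exact h3 y (Finset.mem_univ y)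
  · have hX := below_singleton (T := T) hlow (Finset.mem_univ T.root)
    have hcX := card_below (T := T) hlow (Finset.mem_univ T.root)
    rw [below_root_eq] at hX
    rw [hroot] at hcX
    have hlev : T.level T.root + 1 = 1 := by rw [T.level_root]
    obtain ⟨φ, h1, h2, h3, h4⟩ := embeds hT hF _ 1 (T.childrenIn T.root Finset.univ) Finset.univ
      Finset.univ x₁ x₂ (hlev ▸ isRoots_childrenIn hlow T.root) hlow (Finset.subset_univ _)
      (Finset.mem_univ _) (Finset.mem_univ _) le_rfl (by rw [Finset.card_univ]; omega)
    obtain ⟨ψ, hψ⟩ := key φ h1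
    refine ⟨ψ, ?_, fun y => ?_, fun hch v₂ hv₂ hn1 hn2 hn3 => ?_⟩
    · intro a b hba ha hb
      obtain ⟨w, rfl⟩ := hb
      have hw := Finset.mem_image_of_mem φ (Finset.mem_univ w)
      have haX : a ∈ T.below (T.childrenIn T.root Finset.univ) Finset.univ := by
        have haU := Finset.mem_univ a
        rw [hX, Finset.mem_insert] at haU
        refine haU.resolve_left ?_
        rintro rfl
        have := le_antisymm hba (T.root_le _)
        rw [hψ w] at this
        exact notMem_below_childrenIn T.root Finset.univ (this ▸ h2.1 hw)
      obtain ⟨w', -, hw'⟩ := Finset.mem_image.1 (h2.2 (φ w) hw a haX (hψ w ▸ hba))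
      exact ha ⟨w', (hψ w').trans hw'⟩
    · rw [hψ, hψ]
      exact h3 y (Finset.mem_univ y)
    · rw [hψ]
      have hv : ∃ v₁, v₁ ≠ v₂ ∧ T.children T.root = {v₁, v₂} := by
        obtain ⟨a, b, hab, he⟩ := Set.ncard_eq_two.1 hch
        have := hv₂.1
        rw [he] at this
        rcases this with rfl | h
        · exact ⟨b, hab.symm, he.trans (Set.pair_comm _ _)⟩
        · rw [Set.mem_singleton_iff] at h
          subst h
          exact ⟨a, hab, he⟩
      obtain ⟨v₁, hne, he⟩ := hv
      have hnu : (T.below {v₂} Finset.univ).card = T.nu v₂ := card_below_eq_nu (by simp)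
      refine h4 v₁ v₂ ?_ (lt_of_le_of_ne (hv₂.2 (he ▸ by simp)) hne) (by omega)
        (by rw [Finset.card_univ]; omega) (by rw [Finset.card_univ]; omega)
      ext w
      rw [mem_childrenIn, he]
      simp

/-- The first `i + m` vertices form a lower set, and a final segment with `m` elements of it is
exactly the required interval. -/
lemma isIntervalUniversalWrt (hT : T.IsKsTree 4 1) :
    IsIntervalUniversalWrt (T.generated 2) (monoEquivOfFin V rfl).toEquiv := by
  intro i m him F hF
  obtain ⟨w₀⟩ := hF.connected.nonempty
  set x := monoEquivOfFin V rfl with hx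
  let e : Fin m → V := fun k => x ⟨i + k, by omega⟩
  let H : Finset V := Finset.univ.filter fun y => (x.symm y : ℕ) < i + m
  have hmem : ∀ y, y ∈ H ↔ (x.symm y : ℕ) < i + m := fun y => by simp [H]
  have hlow : IsLowerSet (H : Set V) := by
    intro a b hba ha
    rw [Finset.mem_coe, hmem] at ha ⊢
    exact lt_of_le_of_lt (x.symm.monotone hba) ha
  have heH : ∀ k, e k ∈ H := fun k => by
    rw [hmem, OrderIso.symm_apply_apply]
    simp
  have hinj : Function.Injective e := fun a b hab => by
    have := congrArg Fin.val (x.injective hab)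
    simp only [Nat.add_left_cancel_iff] at this
    exact Fin.ext this
  have hcard : (Finset.univ.image e).card = m := by
    rw [Finset.card_image_of_injective _ hinj, Finset.card_univ, Fintype.card_fin]
  have hJ : (Finset.univ.image e).IsFinal H := by
    refine ⟨fun y hy => ?_, fun y hy z hz hyz => ?_⟩
    · obtain ⟨k, -, rfl⟩ := Finset.mem_image.1 hy
      exact heH k
    · obtain ⟨k, -, rfl⟩ := Finset.mem_image.1 hy
      have h1 : (⟨i + k, by omega⟩ : Fin _) ≤ x.symm z := (x.le_symm_apply).2 hyz
      have h1 : i + k ≤ (x.symm z : ℕ) := h1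
      have h2 := (hmem z).1 hz
      refine Finset.mem_image.2 ⟨⟨(x.symm z : ℕ) - i, by omega⟩, Finset.mem_univ _, ?_⟩
      refine Eq.trans (congrArg x (Fin.ext ?_)) (x.apply_symm_apply z)
      change i + ((x.symm z : ℕ) - i) = x.symm z
      omega
  have hcH := Finset.card_le_card hJ.1
  rw [hcard] at hcH
  obtain ⟨φ, h1, h2, -⟩ := embeds hT hF.isAcyclic _ 0 {T.root} H Finset.univ w₀ w₀
    isRoots_root hlow (Finset.singleton_subset_iff.2 (hlow (T.root_le _) (heH w₀)))
    (Finset.mem_univ _) (Finset.mem_univ _) le_rfl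
    (by rw [below_root_eq, Finset.card_univ, Fintype.card_fin]; exact hcH)
  rw [below_root_eq] at h2
  have hsub := hJ.subset_of_card_le h2
    (by rw [h1.card_image, hcard, Finset.card_univ, Fintype.card_fin])
  have hφ : ∀ w, φ w ∈ {y : V | ∃ j : Fin (Fintype.card V), i ≤ (j : ℕ) ∧ (j : ℕ) < i + m ∧
      x.toEquiv j = y} := by
    intro w
    obtain ⟨k, -, hk⟩ := Finset.mem_image.1 (hsub (Finset.mem_image_of_mem φ (Finset.mem_univ w)))
    exact ⟨⟨i + k, by omega⟩, by simp, by simp, hk⟩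
  exact ⟨⟨⟨fun w => ⟨φ w, hφ w⟩, fun {a b} hab =>
    h1.2 a (Finset.mem_univ a) b (Finset.mem_univ b) hab⟩,
    fun a b hab => h1.1 (by simp) (by simp) (congrArg Subtype.val hab)⟩⟩

end DFSTree

theorem lemma4p3 {V : Type u} [Fintype V] [LinearOrder V] (T : DFSTree V)
    (hT : T.IsKsTree 4 1) :
    IsTreeUniversal (Fintype.card V) (T.generated 2) ∧
    (∀ (W : Type v) [Fintype W] (F : SimpleGraph W), F.IsAcyclic →
      Fintype.card W ≤ Fintype.card V →
      ∀ x₁ x₂ : W, ∃ φ : F.Copy (T.generated 2),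
        T.IsAdmissible (Set.range φ)ᶜ ∧
        (∀ y : W, T.level (φ x₁) ≤ T.level (φ y)) ∧
        ((T.children T.root).ncard = 2 →
          ∀ v₂ : V, IsGreatest (T.children T.root) v₂ →
            2 ≤ T.nu v₂ → T.nu v₂ ≤ Fintype.card W → Fintype.card W + 2 ≤ Fintype.card V →
            T.level (φ x₂) ≤ 2)) ∧
    IsIntervalUniversalWrt (T.generated 2) (monoEquivOfFin V rfl).toEquiv := by
  refine ⟨fun F hF => ?_, fun W _ F hF hc x₁ x₂ => DFSTree.exists_copy hT hF hc x₁ x₂,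
    DFSTree.isIntervalUniversalWrt hT⟩
  obtain ⟨w⟩ := hF.connected.nonempty
  obtain ⟨φ, -⟩ := DFSTree.exists_copy hT hF.isAcyclic (by simp) w w
  exact ⟨φ⟩
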